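/- All graphs are finite, undirected and simple. A \emph{coherent algebra} on a finite set $V$ is a subalgebra $\mathcal A\subseteq \mathrm{Mat}_V(\mathbb C)$ that contains the identity matrix $I$ and the all-ones matrix $J$ and is closed under transposition and under the entrywise product. The \emph{coherent closure} of a graph $\Gamma$ is the smallest coherent algebra on its vertex set that contains its adjacency matrix, and the \emph{coherent rank} of $\Gamma$ is the dimension of its coherent closure over $\mathbb C$. (This is the number of matrices in its basis of $\{0,1\}$-matrices that corresponds to a coherent configuration.) A $2$-$(v,k,\lambda)$ \emph{design} consists of a set of $v$ points and a finite family of blocks, each of which is a set of $k$ points, where $1\le k\le v$, such that any two distinct points lie together in exactly $\lambda$ blocks. It is \emph{symmetric} if it has exactly $v$ blocks and there is an $x$ such that any two blocks (with different indices in the family) meet in exactly $x$ points. Its incidence matrix has rows indexed by points and columns indexed by blocks, with entry $1$ if the point lies in the block and $0$ otherwise. \textbf{Theorem.} Let $\Gamma$ be a connected graph whose adjacency matrix has exactly three distinct eigenvalues, and suppose that $\Gamma$ has coherent rank $8$. Then, for a suitable ordering of its vertices, the adjacency matrix of $\Gamma$ is $$\begin{bmatrix} O & M\\ M^{\top} &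 J-I\end{bmatrix},$$ where $M$ is the incidence matrix of a symmetric $2$-$(\lambda^3-\lambda+1,\lambda^2,\lambda)$ design for some $\lambda\in\mathbb N$. -/

import Mathlib

section CoherentAlgebra

variable {V : Type*} [Fintype V] [DecidableEq V]

/-- A coherent algebra on the finite set `V`: a complex matrix algebra (a subalgebra, so that it
contains the identity matrix) that contains the all-ones matrix and is closed under transposition
and under the entrywise product. -/
structure IsCoherentAlgebra (S : Subalgebra ℂ (Matrix V V ℂ)) : Prop where
  allOnes_mem : (Matrix.of fun _ _ => (1 : ℂ)) ∈ S
  transpose_mem : ∀ M ∈ S, M.transpose ∈ S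
  hadamard_mem : ∀ M ∈ S, ∀ N ∈ S, Matrix.hadamard M N ∈ S

/-- The coherent closure of a graph: the intersection of all coherent algebras that contain its
adjacency matrix. -/
def coherentClosure (G : SimpleGraph V) [DecidableRel G.Adj] : Subalgebra ℂ (Matrix V V ℂ) :=
  sInf {S | IsCoherentAlgebra S ∧ G.adjMatrix ℂ ∈ S}

/-- The coherent rank of a graph: the number of elements in a basis of its coherent closure
(in particular in its basis of 0-1 matrices), that is, the dimension of the closure. -/
noncomputable def coherentRank (G : SimpleGraph V) [DecidableRel G.Adj] : ℕ :=
  Module.finrank ℂ (coherentClosure G)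

/-- The coherent closure is the least coherent algebra that contains the adjacency matrix. -/
theorem coherentClosure_isLeast (G : SimpleGraph V) [DecidableRel G.Adj] :
    IsLeast {S | IsCoherentAlgebra S ∧ G.adjMatrix ℂ ∈ S} (coherentClosure G) := by
  refine ⟨⟨⟨?_, ?_, ?_⟩, ?_⟩, fun S hS => sInf_le hS⟩
  · exact Algebra.mem_sInf.2 fun S hS => hS.1.allOnes_mem
  · exact fun M hM => Algebra.mem_sInf.2 fun S hS =>
      hS.1.transpose_mem M (Algebra.mem_sInf.1 hM S hS)
  · exact fun M hM N hN => Algebra.mem_sInf.2 fun S hS =>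
      hS.1.hadamard_mem M (Algebra.mem_sInf.1 hM S hS) N (Algebra.mem_sInf.1 hN S hS)
  · exact Algebra.mem_sInf.2 fun S hS => hS.2

end CoherentAlgebra

/-- The graph is connected and its adjacency matrix has exactly three distinct eigenvalues. The
adjacency matrix is real symmetric, so all its eigenvalues are real. -/
def IsConnectedWithThreeEigenvalues {V : Type*} [Fintype V] [DecidableEq V]
    (G : SimpleGraph V) [DecidableRel G.Adj] : Prop :=
  G.Connected ∧
    {μ : ℝ | Module.End.HasEigenvalue (Matrix.toLin' (G.adjMatrix ℝ)) μ}.ncard = 3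

section Designs

variable {P B : Type*} [Fintype P] [Fintype B] [DecidableEq P]

/-- A `t`-`(v, k, lam)` design with point set `P` and with the blocks `blk j`, `j : B` (as a
family, so repeated blocks are allowed): there are `v` points, each block is a `k`-set with
`1 ≤ k ≤ v`, and each `t`-set of points is contained in exactly `lam` blocks. -/
structure IsDesign (t v k lam : ℕ) (blk : B → Finset P) : Prop where
  card_points : Fintype.card P = v
  one_le : 1 ≤ k
  le_card : k ≤ v
  card_block : ∀ j, (blk j).card = k
  card_containing : ∀ S : Finset P, S.card = t → (Finset.univ.filter fun j => S ⊆ blk j).card = lam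

/-- A symmetric 2-`(v, k, lam)` design: a 2-design with as many blocks as points, in which any two
blocks meet in the same number of points. -/
structure IsSymmetricTwoDesign (v k lam : ℕ) (blk : B → Finset P) : Prop
    extends IsDesign 2 v k lam blk where
  card_blocks : Fintype.card B = v
  card_inter : ∃ x : ℕ, ∀ i j, i ≠ j → (blk i ∩ blk j).card = x

/-- The incidence matrix of a family of blocks: rows are points, columns are blocks. -/
def blockIncidence (blk : B → Finset P) : Matrix P B ℝ :=
  Matrix.of fun p j => if p ∈ blk j then 1 else 0

end Designs

/-! ### Spectral part: the adjacency matrix satisfies a quadratic up to a rank-one term. -/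

section ThreeEigenvalues

open scoped Matrix

variable {V : Type*} [Fintype V] [DecidableEq V]

/-! Let `θ`, `τ` be the eigenvalues other than the largest. The largest is simple with a positive
eigenvector, so `(A - θ)(A - τ)` has rank one, and `A² = (θ + τ) A - θτ I + v vᵀ` with `v` positive
(`exists_quadratic`). The diagonal shows that `v` depends only on the degree. The coherent closure
contains the all-ones block for every pair of degree classes, so three degrees would force rank at
least 9, while a regular graph has rank at most 3. Hence there are exactly two degrees, and the two
classes form an equitable partition (`exists_isBivalent`).

Everything then turns on the number 8 = 2 + 2 + 4: two diagonal matrices, two pieces of one further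
matrix, and four all-ones blocks. This is the domain of `fibreMap` for two fibres.

If all edges between the classes are present, the part of `A` inside the classes supplies the
further matrix. Rank 8 makes the eight pieces independent, so neither class is complete or empty,
and the parameter equations force equal degrees, a contradiction (`not_joined_of_le_coherentRank`).
Otherwise, since the graph is connected, the part of `A` between the classes is neither empty nor
full. It already yields eight independent members of the closure, which leave nothing to distinguish
pairs inside a class: each class is a clique or a coclique (`exists_fibre_entry`). Two cocliques or
two cliques are impossible (`entry_ne`). For a coclique and a clique, comparing entries of `A²`
gives the design and its parameters (`parameters_of_coclique_clique`, `exists_design`). -/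

theorem Matrix.IsHermitian.mul_sub_eq_zero_of_eigenvalues {A : Matrix V V ℝ} (hA : A.IsHermitian)
    {r s t : ℝ} (h : ∀ i, hA.eigenvalues i = r ∨ hA.eigenvalues i = s ∨ hA.eigenvalues i = t) :
    (A - r • 1) * ((A - s • 1) * (A - t • 1)) = 0 := by
  set φ := Unitary.conjStarAlgAut ℝ (Matrix V V ℝ) hA.eigenvectorUnitary
  have key : A = φ (Matrix.diagonal hA.eigenvalues) := by
    simpa [φ, Unitary.conjStarAlgAut_apply] using hA.spectral_theorem
  have hsub (c : ℝ) : A - c • 1 = φ (Matrix.diagonal (fun i => hA.eigenvalues i - c)) := by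
    have : Matrix.diagonal (fun i => hA.eigenvalues i - c)
        = Matrix.diagonal hA.eigenvalues - c • (1 : Matrix V V ℝ) := by
      ext i j
      by_cases hij : i = j <;> simp [hij]
    rw [this, map_sub, ← key, map_smul, map_one]
  rw [hsub, hsub, hsub, ← map_mul, ← map_mul, Matrix.diagonal_mul_diagonal,
    Matrix.diagonal_mul_diagonal]
  convert map_zero φ
  ext i j
  rw [Matrix.diagonal_apply]
  split_ifs
  · rcases h i with h | h | h <;> simp [h]
  · rfl

theorem Matrix.IsHermitian.hasEigenvalue_eigenvalues {A : Matrix V V ℝ} (hA : A.IsHermitian)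
    (i : V) : Module.End.HasEigenvalue (Matrix.toLin' A) (hA.eigenvalues i) := by
  rw [Module.End.hasEigenvalue_iff_mem_spectrum, Matrix.spectrum_toLin']
  exact hA.eigenvalues_mem_spectrum_real i

theorem Matrix.posSemidef_smul_one_sub {A : Matrix V V ℝ} (hA : A.IsHermitian) {r : ℝ}
    (h : ∀ μ, Module.End.HasEigenvalue (Matrix.toLin' A) μ → μ ≤ r) :
    (r • (1 : Matrix V V ℝ) - A).PosSemidef := by
  have hM : (r • (1 : Matrix V V ℝ) - A).IsHermitian := by
    refine Matrix.IsHermitian.sub ?_ hA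
    ext i j
    by_cases hij : i = j
    · simp [hij]
    · simp [hij, Ne.symm hij]
  rw [hM.posSemidef_iff_eigenvalues_nonneg]
  intro i
  obtain ⟨v, hv⟩ := (hM.hasEigenvalue_eigenvalues i).exists_hasEigenvector
  have hv1 := hv.apply_eq_smul
  have : Module.End.HasEigenvalue (Matrix.toLin' A) (r - hM.eigenvalues i) := by
    refine Module.End.hasEigenvalue_of_hasEigenvector (x := v)
      (Module.End.hasEigenvector_iff.2 ⟨Module.End.mem_eigenspace_iff.2 ?_, hv.2⟩)
    rw [map_sub, LinearMap.sub_apply, map_smul, Matrix.toLin'_one, LinearMap.smul_apply,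
      LinearMap.id_apply, sub_eq_iff_eq_add] at hv1
    rw [sub_smul, hv1]
    abel
  have := h _ this
  simp only [Pi.zero_apply]
  linarith

namespace SimpleGraph

variable {G : SimpleGraph V} [DecidableRel G.Adj]

theorem isHermitian_adjMatrix_real {V : Type*} (G : SimpleGraph V) [DecidableRel G.Adj] :
    (G.adjMatrix ℝ).IsHermitian := by
  rw [Matrix.IsHermitian, Matrix.conjTranspose_eq_transpose_of_trivial, transpose_adjMatrix]

/-- A nonnegative eigenvector of the adjacency matrix of a connected graph has full support. -/
theorem Connected.eq_zero_of_nonneg_eigenvector {V : Type*} [Fintype V]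
    {G : SimpleGraph V} [DecidableRel G.Adj] (hG : G.Connected) {r : ℝ} {v : V → ℝ}
    (hv : ∀ x, 0 ≤ v x) (h : G.adjMatrix ℝ *ᵥ v = r • v) {x : V} (hx : v x = 0) : v = 0 := by
  have step (y z : V) (hyz : G.Adj y z) (hy : v y = 0) : v z = 0 := by
    have h1 := congrFun h y
    rw [adjMatrix_mulVec_apply, Pi.smul_apply, hy, smul_zero,
      Finset.sum_eq_zero_iff_of_nonneg fun i _ => hv i] at h1
    exact h1 z (by simpa using hyz)
  funext z
  obtain ⟨p⟩ := hG.preconnected x z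
  induction p with
  | nil => exact hx
  | cons hadj _ ih => exact ih (step _ _ hadj hx)

/-- The form of `r I - A` is positive semidefinite and vanishes at `v`. Since `A` has nonnegative
entries, passing to absolute values cannot increase the form, so it vanishes at `|v|` too, and a
null vector of a semidefinite form lies in the kernel. -/
theorem abs_eigenvector_of_max {r : ℝ}
    (hr : ∀ μ, Module.End.HasEigenvalue (Matrix.toLin' (G.adjMatrix ℝ)) μ → μ ≤ r)
    {v : V → ℝ} (h : G.adjMatrix ℝ *ᵥ v = r • v) :
    G.adjMatrix ℝ *ᵥ (fun x => |v x|) = r • fun x => |v x| := by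
  have hpsd := Matrix.posSemidef_smul_one_sub G.isHermitian_adjMatrix_real hr
  have hform (w : V → ℝ) : star w ⬝ᵥ ((r • (1 : Matrix V V ℝ) - G.adjMatrix ℝ) *ᵥ w)
      = r * ∑ x, w x * w x - ∑ x, ∑ y, w x * G.adjMatrix ℝ x y * w y := by
    rw [Matrix.sub_mulVec, dotProduct_sub, Matrix.smul_mulVec, Matrix.one_mulVec]
    simp [dotProduct, Matrix.mulVec, Finset.mul_sum, mul_left_comm]
  have h0 : star v ⬝ᵥ ((r • (1 : Matrix V V ℝ) - G.adjMatrix ℝ) *ᵥ v) = 0 := by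
    rw [Matrix.sub_mulVec, h, Matrix.smul_mulVec, Matrix.one_mulVec, sub_self, dotProduct_zero]
  have hle : star (fun x => |v x|) ⬝ᵥ ((r • (1 : Matrix V V ℝ) - G.adjMatrix ℝ) *ᵥ fun x => |v x|)
      ≤ 0 := by
    rw [← h0, hform, hform]
    simp only [abs_mul_abs_self]
    refine sub_le_sub_left (Finset.sum_le_sum fun x _ => Finset.sum_le_sum fun y _ => ?_) _
    rw [mul_assoc, mul_assoc, adjMatrix_apply]
    split_ifs
    · simpa [abs_mul] using le_abs_self (v x * v y)
    · simp
  have h1 := (hpsd.dotProduct_mulVec_zero_iff _).1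
    (le_antisymm hle (hpsd.dotProduct_mulVec_nonneg _))
  rw [Matrix.sub_mulVec, Matrix.smul_mulVec, Matrix.one_mulVec, sub_eq_zero] at h1
  exact h1.symm

/-- The largest eigenvalue of a connected graph has a positive eigenvector, which spans its
eigenspace. -/
theorem Connected.exists_pos_eigenvector (hG : G.Connected) {r : ℝ}
    (hr : Module.End.HasEigenvalue (Matrix.toLin' (G.adjMatrix ℝ)) r)
    (hmax : ∀ μ, Module.End.HasEigenvalue (Matrix.toLin' (G.adjMatrix ℝ)) μ → μ ≤ r) :
    ∃ v : V → ℝ, (∀ x, 0 < v x) ∧ G.adjMatrix ℝ *ᵥ v = r • v ∧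
      ∀ w : V → ℝ, G.adjMatrix ℝ *ᵥ w = r • w → ∃ c : ℝ, w = c • v := by
  obtain ⟨u, hu⟩ := hr.exists_hasEigenvector
  have hu1 : G.adjMatrix ℝ *ᵥ u = r • u := by simpa using hu.apply_eq_smul
  have hv := abs_eigenvector_of_max hmax hu1
  have hpos (x : V) : 0 < |u x| := by
    refine lt_of_le_of_ne (abs_nonneg _) fun h0 => hu.2 ?_
    have := hG.eq_zero_of_nonneg_eigenvector (fun x => abs_nonneg (u x)) hv h0.symm
    funext y
    simpa using congrFun this y
  refine ⟨fun x => |u x|, hpos, hv, fun w hw => ?_⟩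
  obtain ⟨x⟩ := hG.nonempty
  refine ⟨w x / |u x|, ?_⟩
  -- The multiple is chosen so that `z` vanishes at `x`. Then `|z|` is a nonnegative eigenvector
  -- with a zero, hence zero.
  set z : V → ℝ := w - (w x / |u x|) • fun y => |u y|
  have hz : G.adjMatrix ℝ *ᵥ z = r • z := by
    rw [Matrix.mulVec_sub, Matrix.mulVec_smul, hv, hw, smul_sub, smul_comm]
  have hzx : z x = 0 := by
    simp [z, (hpos x).ne']
  have := hG.eq_zero_of_nonneg_eigenvector (fun y => abs_nonneg (z y))
    (abs_eigenvector_of_max hmax hz) (x := x) (by simp [hzx])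
  have hz0 : z = 0 := by
    funext y
    simpa using congrFun this y
  exact sub_eq_zero.1 hz0

end SimpleGraph

open SimpleGraph in
/-- The quadratic equation satisfied by the adjacency matrix of a connected graph with three
distinct eigenvalues. -/
theorem IsConnectedWithThreeEigenvalues.exists_quadratic {G : SimpleGraph V} [DecidableRel G.Adj]
    (hG : IsConnectedWithThreeEigenvalues G) :
    ∃ (r s t : ℝ) (v : V → ℝ), s ≠ t ∧ (∀ x, 0 < v x) ∧ G.adjMatrix ℝ *ᵥ v = r • v ∧
      ∀ x y, (G.adjMatrix ℝ * G.adjMatrix ℝ) x y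
        = (s + t) * G.adjMatrix ℝ x y - s * t * (if x = y then 1 else 0) + v x * v y := by
  obtain ⟨hconn, hcard⟩ := hG
  set A := G.adjMatrix ℝ with hAdef
  have hA : A.IsHermitian := G.isHermitian_adjMatrix_real
  obtain ⟨r, s, t, hrs, hrt, hst, hE, hmax⟩ : ∃ r s t : ℝ, r ≠ s ∧ r ≠ t ∧ s ≠ t ∧
      {μ : ℝ | Module.End.HasEigenvalue (Matrix.toLin' A) μ} = {r, s, t} ∧ s ≤ r ∧ t ≤ r := by
    obtain ⟨a, b, c, hab, hac, hbc, hE⟩ := Set.ncard_eq_three.1 hcard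
    rcases le_total a b with h1 | h1 <;> rcases le_total b c with h2 | h2 <;>
      rcases le_total a c with h3 | h3
    · exact ⟨c, a, b, hac.symm, hbc.symm, hab, by rw [hE]; ext; simp; tauto, h3, h2⟩
    · exact ⟨c, a, b, hac.symm, hbc.symm, hab, by rw [hE]; ext; simp; tauto, h1.trans h2, h2⟩
    · exact ⟨b, a, c, hab.symm, hbc, hac, by rw [hE]; ext; simp; tauto, h1, h2⟩
    · exact ⟨b, a, c, hab.symm, hbc, hac, by rw [hE]; ext; simp; tauto, h1, h2⟩
    · exact ⟨c, a, b, hac.symm, hbc.symm, hab, by rw [hE]; ext; simp; tauto, h3, h2⟩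
    · exact ⟨a, b, c, hab, hac, hbc, hE, h1, h3⟩
    · exact ⟨a, b, c, hab, hac, hbc, hE, h1, h2.trans h1⟩
    · exact ⟨a, b, c, hab, hac, hbc, hE, h1, h3⟩
  have hmem (μ : ℝ) : Module.End.HasEigenvalue (Matrix.toLin' A) μ ↔ μ = r ∨ μ = s ∨ μ = t := by
    simpa using Set.ext_iff.1 hE μ
  obtain ⟨v, hvpos, hv, hspan⟩ := hconn.exists_pos_eigenvector ((hmem r).2 (.inl rfl))
    (fun μ hμ => by
      rcases (hmem μ).1 hμ with rfl | rfl | rfl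
      exacts [le_rfl, hmax.1, hmax.2])
  have hzero := hA.mul_sub_eq_zero_of_eigenvalues (r := r) (s := s) (t := t)
    fun i => (hmem _).1 (hA.hasEigenvalue_eigenvalues i)
  -- `A - r` annihilates `B`, so every column of `B` is a multiple of `v`. By symmetry `B` is then a
  -- multiple of `v vᵀ`.
  set B := (A - s • 1) * (A - t • 1) with hB
  have hBxy (x y : V) : B x y
      = (A * A) x y - (s + t) * A x y + s * t * (if x = y then 1 else 0) := by
    have : B = A * A - (s + t) • A + (s * t) • (1 : Matrix V V ℝ) := by
      rw [hB]
      simp only [mul_sub, sub_mul, Matrix.smul_mul, Matrix.mul_smul, one_mul, mul_one, smul_smul,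
        add_smul]
      rw [mul_comm t s]
      abel
    rw [this]
    simp [Matrix.one_apply]
  have hBsymm (x y : V) : B x y = B y x := by
    have h1 : (A * A) x y = (A * A) y x := by
      have : (A * A).transpose = A * A := by
        rw [Matrix.transpose_mul, hAdef, transpose_adjMatrix]
      exact congrFun (congrFun this y) x
    have h2 : A x y = A y x := by simp [hAdef, adjMatrix_apply, G.adj_comm]
    rw [hBxy, hBxy, h1, h2]
    simp [eq_comm]
  have hcol (y : V) : ∃ c : ℝ, ∀ x, B x y = c * v x := by
    obtain ⟨c, hc⟩ := hspan (fun x => B x y) (by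
      funext x
      have := congrFun (congrFun hzero x) y
      rw [sub_mul, Matrix.smul_mul, one_mul, Matrix.sub_apply, Matrix.zero_apply, sub_eq_zero]
        at this
      exact this)
    exact ⟨c, fun x => congrFun hc x⟩
  choose c hc using hcol
  obtain ⟨x₀⟩ := hconn.nonempty
  have hBform (x y : V) : B x y = c x₀ / v x₀ * (v x * v y) := by
    have h1 := hBsymm x₀ y
    rw [hc, hc] at h1
    rw [hc]
    field_simp [(hvpos x₀).ne']
    linear_combination (v x) * h1
  -- The sign comes from `B v = (r - s)(r - t) v`. Positivity allows the coefficient to be absorbed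
  -- into `v` through its square root.
  have hpos : 0 < c x₀ / v x₀ := by
    have hBv : B *ᵥ v = ((r - s) * (r - t)) • v := by
      have h1 (d : ℝ) : (A - d • 1) *ᵥ v = (r - d) • v := by
        rw [Matrix.sub_mulVec, hv, Matrix.smul_mulVec, Matrix.one_mulVec, sub_smul]
      rw [hB, ← Matrix.mulVec_mulVec, h1, Matrix.mulVec_smul, h1, smul_smul, mul_comm]
    have h2 := congrFun hBv x₀
    simp only [Matrix.mulVec, dotProduct, hBform, Pi.smul_apply, smul_eq_mul] at h2
    have h3 : ∑ y, c x₀ / v x₀ * (v x₀ * v y) * v y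
        = c x₀ / v x₀ * (v x₀ * ∑ y, v y * v y) := by
      simp [Finset.mul_sum, mul_assoc]
    have h4 : 0 < (r - s) * (r - t) * v x₀ := by
      have := lt_of_le_of_ne hmax.1 hrs.symm
      have := lt_of_le_of_ne hmax.2 hrt.symm
      exact mul_pos (mul_pos (by linarith) (by linarith)) (hvpos x₀)
    have h5 : 0 ≤ v x₀ * ∑ y, v y * v y :=
      mul_nonneg (hvpos x₀).le (Finset.sum_nonneg fun y _ => mul_self_nonneg _)
    rw [← h2, h3] at h4
    exact pos_of_mul_pos_left h4 h5
  refine ⟨r, s, t, Real.sqrt (c x₀ / v x₀) • v, hst, fun x => mul_pos (Real.sqrt_pos.2 hpos)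
    (hvpos x), ?_, fun x y => ?_⟩
  · rw [Matrix.mulVec_smul, hv, smul_comm]
  · have h1 := hBxy x y
    rw [hBform] at h1
    have h2 := Real.mul_self_sqrt hpos.le
    simp only [Pi.smul_apply, smul_eq_mul]
    linear_combination -h1 - (v x * v y) * h2

end ThreeEigenvalues

/-! ### Coherent algebras spanned by diagonal matrices, one matrix inside the fibres, and all-ones
blocks. -/

section FibreMap

variable {V ι : Type*} [DecidableEq V]

/-- The matrices with entries `u (f x) * δ x y + v (f x) * B x y + w (f x) (f y)`. -/
def fibreMap (f : V → ι) (B : Matrix V V ℂ) :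
    ((ι → ℂ) × (ι → ℂ) × (ι → ι → ℂ)) →ₗ[ℂ] Matrix V V ℂ where
  toFun c := Matrix.of fun x y =>
    c.1 (f x) * (if x = y then 1 else 0) + c.2.1 (f x) * B x y + c.2.2 (f x) (f y)
  map_add' c d := by
    ext x y
    simp only [Prod.fst_add, Prod.snd_add, Pi.add_apply, Matrix.of_apply, Matrix.add_apply]
    ring
  map_smul' a c := by
    ext x y
    simp only [Prod.smul_fst, Prod.smul_snd, Pi.smul_apply, Matrix.of_apply, Matrix.smul_apply,
      smul_eq_mul, RingHom.id_apply]
    ring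

theorem fibreMap_apply (f : V → ι) (B : Matrix V V ℂ) (u v : ι → ℂ) (w : ι → ι → ℂ) (x y : V) :
    fibreMap f B (u, v, w) x y
      = u (f x) * (if x = y then 1 else 0) + v (f x) * B x y + w (f x) (f y) := rfl

/-- A `0`-`1` matrix inside the fibres of `f` that spans, with the trivial matrices of the fibres,
a coherent algebra. -/
structure IsFibrewiseRegular {R : Type*} [CommRing R] [Fintype V] (f : V → ι)
    (B : Matrix V V R) : Prop where
  idem : ∀ x y, B x y * B x y = B x y
  diag : ∀ x, B x x = 0
  symm : ∀ x y, B x y = B y x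
  supp : ∀ x y, f x ≠ f y → B x y = 0
  row : ∃ κ : ι → R, ∀ x, ∑ y, B x y = κ (f x)
  sq : ∃ (σ ρ : ι → R) (ω : ι → ι → R), ∀ x y, ∑ z, B x z * B z y
    = σ (f x) * B x y + ρ (f x) * (if x = y then 1 else 0) + ω (f x) (f y)

namespace IsFibrewiseRegular

variable [Fintype V] {f : V → ι} {B : Matrix V V ℂ}

theorem map {R S : Type*} [CommRing R] [CommRing S] {B : Matrix V V R}
    (h : IsFibrewiseRegular f B) (φ : R →+* S) : IsFibrewiseRegular f (B.map φ) where
  idem x y := by rw [Matrix.map_apply, ← map_mul, h.idem]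
  diag x := by rw [Matrix.map_apply, h.diag, map_zero]
  symm x y := by rw [Matrix.map_apply, h.symm, Matrix.map_apply]
  supp x y hxy := by rw [Matrix.map_apply, h.supp x y hxy, map_zero]
  row := by
    obtain ⟨κ, hκ⟩ := h.row
    exact ⟨fun i => φ (κ i), fun x => by simp only [Matrix.map_apply, ← map_sum, hκ]⟩
  sq := by
    obtain ⟨σ, ρ, ω, hsq⟩ := h.sq
    refine ⟨fun i => φ (σ i), fun i => φ (ρ i), fun i j => φ (ω i j), fun x y => ?_⟩
    have := congrArg φ (hsq x y)
    simpa [apply_ite φ] using this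

/-- Since `B` lives inside the fibres, a coefficient at the middle vertex of a product with `B` can
be moved to an end vertex. The remaining sums are row sums of `B`, entries of `B²`, and sums of
block coefficients. -/
theorem mul_mem_range (h : IsFibrewiseRegular f B) {M N : Matrix V V ℂ}
    (hM : M ∈ LinearMap.range (fibreMap f B)) (hN : N ∈ LinearMap.range (fibreMap f B)) :
    M * N ∈ LinearMap.range (fibreMap f B) := by
  obtain ⟨⟨u, v, w⟩, rfl⟩ := hM
  obtain ⟨⟨u', v', w'⟩, rfl⟩ := hN
  obtain ⟨κ, hκ⟩ := h.row
  obtain ⟨σ, ρ, ω, hsq⟩ := h.sq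
  have hκ' (y : V) : ∑ x, B x y = κ (f y) := by
    rw [← hκ]
    exact Finset.sum_congr rfl fun x _ => h.symm x y
  have hBl (g : ι → ℂ) (x z : V) : B x z * (g (f z) - g (f x)) = 0 := by
    by_cases hxz : f x = f z
    · rw [hxz, sub_self, mul_zero]
    · rw [h.supp x z hxz, zero_mul]
  have hδ (g : V → ℂ) (z y : V) : (if z = y then (1 : ℂ) else 0) * (g z - g y) = 0 := by
    split_ifs with hzy <;> simp [hzy]
  refine ⟨(fun i => u i * u' i + v i * v' i * ρ i,
    fun i => u i * v' i + v i * u' i + v i * v' i * σ i,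
    fun i j => u i * w' i j + v i * v' i * ω i j + v i * w' i j * κ i + w i j * u' j
      + w i j * v' j * κ j + ∑ z, w i (f z) * w' (f z) j), ?_⟩
  ext x y
  have hterm (z : V) : fibreMap f B (u, v, w) x z * fibreMap f B (u', v', w') z y
      = (if x = z then (1 : ℂ) else 0) * (u (f x) * fibreMap f B (u', v', w') x y)
        + v (f x) * v' (f x) * (B x z * B z y)
        + (if z = y then (1 : ℂ) else 0) * (v (f x) * u' (f x) * B x y + w (f x) (f y) * u' (f y))
        + v (f x) * w' (f x) (f y) * B x z + w (f x) (f y) * v' (f y) * B z y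
        + w (f x) (f z) * w' (f z) (f y) := by
    have e1 := hBl v' x z
    have e2 := hBl u' x z
    have e3 := hBl (fun i => w' i (f y)) x z
    have e4 := hδ (fun z => w (f x) (f z) * u' (f z)) z y
    have e5 := hBl (fun i => w (f x) i * v' i) y z
    have e6 := hδ (fun z => B x z) z y
    have e7 := hδ (fun z => fibreMap f B (u', v', w') z y) x z
    rw [h.symm y z] at e5
    simp only [fibreMap_apply] at e7 ⊢
    linear_combination v (f x) * B z y * e1 + v (f x) * (if z = y then (1 : ℂ) else 0) * e2
      + v (f x) * e3 + e4 + e5 + v (f x) * u' (f x) * e6 - u (f x) * e7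
  rw [Matrix.mul_apply, Finset.sum_congr rfl fun z _ => hterm z]
  simp only [Finset.sum_add_distrib, ← Finset.mul_sum, ← Finset.sum_mul, hsq, hκ, hκ',
    Finset.sum_ite_eq, Finset.sum_ite_eq', Finset.mem_univ, if_true, one_mul, fibreMap_apply]
  ring

theorem hadamard_mem_range (h : IsFibrewiseRegular f B) {M N : Matrix V V ℂ}
    (hM : M ∈ LinearMap.range (fibreMap f B)) (hN : N ∈ LinearMap.range (fibreMap f B)) :
    M.hadamard N ∈ LinearMap.range (fibreMap f B) := by
  obtain ⟨⟨u, v, w⟩, rfl⟩ := hM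
  obtain ⟨⟨u', v', w'⟩, rfl⟩ := hN
  refine ⟨(fun i => u i * u' i + u i * w' i i + w i i * u' i,
    fun i => v i * v' i + v i * w' i i + w i i * v' i, fun i j => w i j * w' i j), ?_⟩
  ext x y
  simp only [Matrix.hadamard_apply, fibreMap_apply]
  by_cases hxy : x = y
  · subst hxy
    simp only [h.diag, if_true]
    ring
  · by_cases hf : f x = f y
    · simp only [hxy, if_false, ← hf]
      linear_combination -(v (f x) * v' (f x)) * h.idem x y
    · simp only [hxy, if_false, h.supp x y hf]
      ring

theorem transpose_mem_range (h : IsFibrewiseRegular f B) {M : Matrix V V ℂ}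
    (hM : M ∈ LinearMap.range (fibreMap f B)) :
    M.transpose ∈ LinearMap.range (fibreMap f B) := by
  obtain ⟨⟨u, v, w⟩, rfl⟩ := hM
  refine ⟨(u, v, fun i j => w j i), ?_⟩
  ext x y
  rw [Matrix.transpose_apply, fibreMap_apply, fibreMap_apply, h.symm y x]
  by_cases hxy : x = y
  · subst hxy
    rfl
  · by_cases hf : f x = f y
    · simp [hxy, Ne.symm hxy, hf]
    · simp [hxy, Ne.symm hxy, h.supp x y hf]

/-- The coherent algebra of the matrices `fibreMap f B c`. -/
def toSubalgebra (h : IsFibrewiseRegular f B) : Subalgebra ℂ (Matrix V V ℂ) :=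
  (LinearMap.range (fibreMap f B)).toSubalgebra
    ⟨(fun _ => 1, 0, 0), by ext x y; simp [fibreMap_apply, Matrix.one_apply]⟩
    fun _ _ => h.mul_mem_range

theorem isCoherentAlgebra (h : IsFibrewiseRegular f B) : IsCoherentAlgebra h.toSubalgebra where
  allOnes_mem := ⟨(0, 0, fun _ _ => 1), by ext x y; simp [fibreMap_apply]⟩
  transpose_mem _ := h.transpose_mem_range
  hadamard_mem _ hM _ hN := h.hadamard_mem_range hM hN

theorem coherentRank_le (h : IsFibrewiseRegular f B) {G : SimpleGraph V} [DecidableRel G.Adj]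
    (hG : G.adjMatrix ℂ ∈ LinearMap.range (fibreMap f B)) :
    coherentRank G ≤ Module.finrank ℂ (LinearMap.range (fibreMap f B)) := by
  have hle : coherentClosure G ≤ h.toSubalgebra :=
    (coherentClosure_isLeast G).2 ⟨h.isCoherentAlgebra, hG⟩
  have : Module.Finite ℂ (LinearMap.range (fibreMap f B)) :=
    FiniteDimensional.finiteDimensional_submodule _
  exact Submodule.finrank_mono (R := ℂ) (s := Subalgebra.toSubmodule (coherentClosure G))
    (t := LinearMap.range (fibreMap f B)) hle

end IsFibrewiseRegular

theorem finrank_fibreMap_domain (ι : Type*) [Fintype ι] :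
    Module.finrank ℂ ((ι → ℂ) × (ι → ℂ) × (ι → ι → ℂ))
      = 2 * Fintype.card ι + Fintype.card ι ^ 2 := by
  simp only [Module.finrank_prod, Module.finrank_pi, Module.finrank_pi_fintype, Finset.sum_const,
    Finset.card_univ, smul_eq_mul]
  ring

/-- The closure lies in the range of `fibreMap`; if its rank reaches the dimension of the domain,
rank-nullity leaves no kernel. For two fibres the threshold is 8. -/
theorem IsFibrewiseRegular.injective [Fintype V] [Fintype ι] {f : V → ι} {B : Matrix V V ℂ}
    (h : IsFibrewiseRegular f B) {G : SimpleGraph V} [DecidableRel G.Adj]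
    (hG : G.adjMatrix ℂ ∈ LinearMap.range (fibreMap f B))
    (hrank : 2 * Fintype.card ι + Fintype.card ι ^ 2 ≤ coherentRank G) :
    Function.Injective (fibreMap f B) := by
  have h1 := h.coherentRank_le hG
  have h2 := (fibreMap f B).finrank_range_add_finrank_ker
  rw [finrank_fibreMap_domain] at h2
  rw [← LinearMap.ker_eq_bot, ← Submodule.finrank_eq_zero (R := ℂ)]
  omega

end FibreMap

/-! ### Matrices forced into the coherent closure by the degrees. -/

section ClosureMembers

variable {V ι : Type*} [Fintype V] [DecidableEq V] (G : SimpleGraph V) [DecidableRel G.Adj]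

/-- The entrywise product of `A²` with `I` is the diagonal matrix of degrees. Lagrange interpolation
turns any function of the degree into a polynomial in that matrix. -/
theorem diagonal_degree_mem_coherentClosure (g : ℕ → ℂ) :
    Matrix.diagonal (fun x => g (G.degree x)) ∈ coherentClosure G := by
  obtain ⟨⟨hS, hA⟩, -⟩ := coherentClosure_isLeast G
  have hD : Matrix.diagonal (fun x => (G.degree x : ℂ)) ∈ coherentClosure G := by
    have := hS.hadamard_mem _ (mul_mem hA hA) _ (one_mem _)
    convert this using 1
    ext x y
    by_cases hxy : x = y
    · subst hxy
      simp only [Matrix.diagonal_apply_eq, Matrix.hadamard_apply, Matrix.one_apply_eq, mul_one]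
      rw [SimpleGraph.adjMatrix_mul_self_apply_self]
    · simp [hxy]
  obtain ⟨p, hp⟩ : ∃ p : Polynomial ℂ, ∀ x : V, p.eval (G.degree x : ℂ) = g (G.degree x) := by
    refine ⟨Lagrange.interpolate (Finset.univ.image fun x => G.degree x) (fun n : ℕ => (n : ℂ)) g,
      fun x => ?_⟩
    exact Lagrange.eval_interpolate_at_node (v := fun n : ℕ => (n : ℂ)) g
      Nat.cast_injective.injOn (Finset.mem_image_of_mem (fun x => G.degree x) (Finset.mem_univ x))
  have h1 : Polynomial.aeval (Matrix.diagonal (fun x => (G.degree x : ℂ))) p ∈ coherentClosure G :=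
    Algebra.adjoin_le (Set.singleton_subset_iff.2 hD) (Polynomial.aeval_mem_adjoin_singleton _ _)
  convert h1 using 1
  have h2 : Matrix.diagonal (fun x => (G.degree x : ℂ))
      = Matrix.diagonalAlgHom ℂ (fun x => (G.degree x : ℂ)) := rfl
  rw [h2, Polynomial.aeval_algHom_apply, Polynomial.aeval_pi_apply]
  simp [hp]

theorem of_degree_mem_coherentClosure [Fintype ι] [DecidableEq ι] (F : ℕ → ι) (w : ι → ι → ℂ) :
    Matrix.of (fun x y => w (F (G.degree x)) (F (G.degree y))) ∈ coherentClosure G := by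
  obtain ⟨⟨hS, -⟩, -⟩ := coherentClosure_isLeast G
  -- The all-ones block between two classes is `J` multiplied on both sides by diagonal indicators.
  have h (i j : ι) := mul_mem (mul_mem
    (diagonal_degree_mem_coherentClosure G fun n => if F n = i then 1 else 0) hS.allOnes_mem)
    (diagonal_degree_mem_coherentClosure G fun n => if F n = j then 1 else 0)
  have := sum_mem (t := Finset.univ) fun i _ => sum_mem (t := Finset.univ) fun j _ =>
    Subalgebra.smul_mem _ (h i j) (w i j)
  convert this using 1
  ext x y
  simp [Matrix.sum_apply, Matrix.diagonal_mul, Matrix.mul_diagonal]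

theorem sq_card_le_coherentRank [Fintype ι] [DecidableEq ι] (F : ℕ → ι)
    (hF : Function.Surjective fun x => F (G.degree x)) :
    Fintype.card ι ^ 2 ≤ coherentRank G := by
  let ψ : (ι → ι → ℂ) →ₗ[ℂ] coherentClosure G :=
    { toFun := fun w => ⟨_, of_degree_mem_coherentClosure G F w⟩
      map_add' := fun _ _ => rfl
      map_smul' := fun _ _ => rfl }
  have hψ : Function.Injective ψ := by
    intro w w' hw
    funext i j
    obtain ⟨x, rfl⟩ := hF i
    obtain ⟨y, rfl⟩ := hF j
    exact congrFun (congrFun (congrArg Subtype.val hw) x) y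
  have := LinearMap.finrank_le_finrank_of_injective hψ
  simpa [coherentRank, Module.finrank_pi_fintype, sq] using this

theorem range_fibreMap_le_coherentClosure [Fintype ι] [DecidableEq ι] (F : ℕ → ι)
    {B : Matrix V V ℂ} (hB : B ∈ coherentClosure G) :
    LinearMap.range (fibreMap (fun x => F (G.degree x)) B)
      ≤ Subalgebra.toSubmodule (coherentClosure G) := by
  rintro _ ⟨⟨u, v, w⟩, rfl⟩
  have := add_mem (add_mem (diagonal_degree_mem_coherentClosure G fun n => u (F n))
    (mul_mem (diagonal_degree_mem_coherentClosure G fun n => v (F n)) hB))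
    (of_degree_mem_coherentClosure G F w)
  rw [Subalgebra.mem_toSubmodule]
  convert this using 1
  ext x y
  simp [fibreMap_apply, Matrix.diagonal_apply]

/-- Here `B` need not lie inside the fibres: the range is contained in the closure and, being of
full dimension, fills it. -/
theorem mem_range_fibreMap_of_injective [Fintype ι] [DecidableEq ι] (F : ℕ → ι)
    {B : Matrix V V ℂ} (hB : B ∈ coherentClosure G)
    (hinj : Function.Injective (fibreMap (fun x => F (G.degree x)) B))
    (hrank : coherentRank G ≤ 2 * Fintype.card ι + Fintype.card ι ^ 2) {M : Matrix V V ℂ}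
    (hM : M ∈ coherentClosure G) :
    M ∈ LinearMap.range (fibreMap (fun x => F (G.degree x)) B) := by
  have h1 := LinearMap.finrank_range_of_inj hinj
  rw [finrank_fibreMap_domain] at h1
  have h2 := Submodule.eq_of_le_of_finrank_le (range_fibreMap_le_coherentClosure G F hB)
    (h1.symm ▸ hrank)
  rw [h2]
  exact hM

end ClosureMembers

/-! ### Reduction to two degrees, and the equations of the quotient matrix. -/

section Bivalent

variable {V : Type*} [Fintype V] [DecidableEq V]

/-- A graph whose vertices fall into two fibres `f x = false` and `f x = true`, where each fibre
has its own entry in a positive eigenvector, whose adjacency matrix `A` satisfies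
`A ^ 2 = s A + p I + a aᵀ`, and for which the two fibres form an equitable partition with quotient
matrix `Q`. -/
structure IsBivalent (G : SimpleGraph V) [DecidableRel G.Adj] (f : V → Bool) (s p : ℝ)
    (a : Bool → ℝ) (Q : Bool → Bool → ℝ) : Prop where
  surj : Function.Surjective f
  pos : ∀ i, 0 < a i
  ne : a false ≠ a true
  sq : ∀ x y, (G.adjMatrix ℝ * G.adjMatrix ℝ) x y
    = s * G.adjMatrix ℝ x y + p * (if x = y then 1 else 0) + a (f x) * a (f y)
  row : ∀ x i, ∑ y, G.adjMatrix ℝ x y * (if f y = i then 1 else 0) = Q (f x) i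

theorem SimpleGraph.sum_adjMatrix_row {V : Type*} [Fintype V] (G : SimpleGraph V)
    [DecidableRel G.Adj] (x : V) :
    ∑ y, G.adjMatrix ℝ x y = G.degree x := by
  simp [SimpleGraph.adjMatrix_apply, ← SimpleGraph.card_neighborFinset_eq_degree,
    SimpleGraph.neighborFinset_eq_filter]

theorem SimpleGraph.adjMatrix_comm {V : Type*} (G : SimpleGraph V) [DecidableRel G.Adj] (x y : V) :
    G.adjMatrix ℝ x y = G.adjMatrix ℝ y x := by
  simp [SimpleGraph.adjMatrix_apply, G.adj_comm]

theorem SimpleGraph.isFibrewiseRegular_adjMatrix {G : SimpleGraph V} [DecidableRel G.Adj]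
    {d : ℕ} (hd : ∀ x, G.degree x = d) {s p c : ℝ}
    (hsq : ∀ x y, (G.adjMatrix ℝ * G.adjMatrix ℝ) x y
      = s * G.adjMatrix ℝ x y + p * (if x = y then 1 else 0) + c) :
    IsFibrewiseRegular (fun _ : V => ()) (G.adjMatrix ℝ) where
  idem x y := by simp [SimpleGraph.adjMatrix_apply]
  diag x := by simp
  symm x y := by simp [SimpleGraph.adjMatrix_apply, G.adj_comm]
  supp x y h := absurd rfl h
  row := ⟨fun _ => d, fun x => by rw [G.sum_adjMatrix_row, hd]⟩
  sq := ⟨fun _ => s, fun _ => p, fun _ _ => c, fun x y => by rw [← hsq, Matrix.mul_apply]⟩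

theorem SimpleGraph.map_ofReal_adjMatrix {V : Type*} (G : SimpleGraph V) [DecidableRel G.Adj] :
    (G.adjMatrix ℝ).map Complex.ofRealHom = G.adjMatrix ℂ := by
  ext x y
  simp [SimpleGraph.adjMatrix_apply, apply_ite]

/-- With a single fibre, the span of `I`, `A` and `J` is already a coherent algebra. -/
theorem SimpleGraph.coherentRank_le_three_of_regular {G : SimpleGraph V} [DecidableRel G.Adj]
    {d : ℕ} (hd : ∀ x, G.degree x = d) {s p c : ℝ}
    (hsq : ∀ x y, (G.adjMatrix ℝ * G.adjMatrix ℝ) x y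
      = s * G.adjMatrix ℝ x y + p * (if x = y then 1 else 0) + c) :
    coherentRank G ≤ 3 := by
  have h := (G.isFibrewiseRegular_adjMatrix hd hsq).map Complex.ofRealHom
  rw [G.map_ofReal_adjMatrix] at h
  refine (h.coherentRank_le ⟨(0, fun _ => 1, 0), ?_⟩).trans ?_
  · ext x y
    simp [fibreMap_apply]
  · refine (LinearMap.finrank_range_le _).trans ?_
    rw [finrank_fibreMap_domain]
    simp

theorem IsConnectedWithThreeEigenvalues.exists_isBivalent {G : SimpleGraph V} [DecidableRel G.Adj]
    (hG : IsConnectedWithThreeEigenvalues G) (hlow : 3 < coherentRank G)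
    (hhigh : coherentRank G < 9) :
    ∃ (F : ℕ → Bool) (θ τ : ℝ) (a : Bool → ℝ) (Q : Bool → Bool → ℝ), θ ≠ τ ∧
      IsBivalent G (fun x => F (G.degree x)) (θ + τ) (-(θ * τ)) a Q := by
  obtain ⟨r, θ, τ, v, hne, hpos, hv, hsq⟩ := hG.exists_quadratic
  obtain ⟨x₀⟩ := hG.1.nonempty
  have hdeg (x : V) : (G.degree x : ℝ) = -(θ * τ) + v x * v x := by
    have := hsq x x
    rw [SimpleGraph.adjMatrix_mul_self_apply_self] at this
    simpa using this
  have hdv (x y : V) (h : G.degree x = G.degree y) : v x = v y := by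
    have h1 := hdeg x
    rw [h, hdeg y, add_right_inj] at h1
    exact (mul_self_inj (hpos x).le (hpos y).le).1 h1.symm
  have hvd (x y : V) (h : v x = v y) : G.degree x = G.degree y := by
    have : (G.degree x : ℝ) = G.degree y := by rw [hdeg, hdeg, h]
    exact_mod_cast this
  obtain ⟨x₁, hx₁⟩ : ∃ x₁, G.degree x₁ ≠ G.degree x₀ := by
    by_contra! hreg
    refine absurd (SimpleGraph.coherentRank_le_three_of_regular hreg (s := θ + τ) (p := -(θ * τ))
      (c := v x₀ * v x₀) fun x y => ?_) (not_le.2 hlow)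
    rw [hsq, hdv x x₀ (hreg x), hdv y x₀ (hreg y)]
    ring
  -- A third degree would give nine independent all-ones blocks.
  have htwo (y : V) : G.degree y = G.degree x₀ ∨ G.degree y = G.degree x₁ := by
    by_contra! hy
    have := sq_card_le_coherentRank G (ι := Fin 3)
      (fun n => if n = G.degree x₀ then 0 else if n = G.degree x₁ then 1 else 2) (by
        intro i
        fin_cases i
        · exact ⟨x₀, by simp⟩
        · exact ⟨x₁, by simp [hx₁]⟩
        · exact ⟨y, by simp [hy.1, hy.2]⟩)
    simp at this
    omega
  let F : ℕ → Bool := fun n => decide (n = G.degree x₁)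
  have hF₀ : F (G.degree x₀) = false := by simp [F, hx₁.symm]
  have hF₁ : F (G.degree x₁) = true := by simp [F]
  let rep : Bool → V := fun i => cond i x₁ x₀
  have hrep (y : V) : G.degree y = G.degree (rep (F (G.degree y))) := by
    rcases htwo y with h | h
    · rw [h, hF₀]; rfl
    · rw [h, hF₁]; rfl
  have hFrep (i : Bool) : F (G.degree (rep i)) = i := by
    cases i
    · exact hF₀
    · exact hF₁
  -- The neighbour counts of `x` in the two fibres satisfy two linear equations, from the degree and
  -- from the eigenvector. Their determinant is `v x₁ - v x₀ ≠ 0`, so the counts depend only on the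
  -- degree of `x`.
  let N : V → Bool → ℝ := fun x i =>
    ∑ y, G.adjMatrix ℝ x y * (if F (G.degree y) = i then 1 else 0)
  have hne' : v x₀ ≠ v x₁ := fun h => hx₁ (hvd _ _ h).symm
  have hN1 (x : V) : N x false + N x true = G.degree x := by
    simp only [N, ← Finset.sum_add_distrib, ← mul_add]
    have : ∀ y, ((if F (G.degree y) = false then (1 : ℝ) else 0)
        + if F (G.degree y) = true then 1 else 0) = 1 := by
      intro y
      cases F (G.degree y) <;> simp
    simp only [this, mul_one, G.sum_adjMatrix_row]
  have hN2 (x : V) : v x₀ * N x false + v x₁ * N x true = r * v x := by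
    have h1 := congrFun hv x
    rw [Pi.smul_apply, smul_eq_mul] at h1
    rw [← h1]
    simp only [N, Finset.mul_sum, ← Finset.sum_add_distrib, Matrix.mulVec, dotProduct]
    refine Finset.sum_congr rfl fun y _ => ?_
    rw [hdv y _ (hrep y)]
    cases F (G.degree y) <;> simp [rep, mul_comm]
  refine ⟨F, θ, τ, fun i => v (rep i), fun i j => N (rep i) j, hne, ?_, fun i => hpos _, hne',
    fun x y => ?_, fun x i => ?_⟩
  · exact fun i => ⟨rep i, hFrep i⟩
  · rw [hsq, ← hdv x _ (hrep x), ← hdv y _ (hrep y)]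
    ring
  · change N x i = N (rep (F (G.degree x))) i
    have e1 := hN1 x
    have e2 := hN2 x
    rw [hrep x, ← hN1] at e1
    rw [hdv x _ (hrep x), ← hN2] at e2
    have h1 : N x true = N (rep (F (G.degree x))) true := by
      have : (v x₁ - v x₀) * (N x true - N (rep (F (G.degree x))) true) = 0 := by
        linear_combination e2 - v x₀ * e1
      rcases mul_eq_zero.1 this with h | h
      · exact absurd (sub_eq_zero.1 h).symm hne'
      · exact sub_eq_zero.1 h
    cases i
    · linarith
    · exact h1

namespace IsBivalent

variable {G : SimpleGraph V} [DecidableRel G.Adj] {f : V → Bool} {s p : ℝ} {a : Bool → ℝ}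
  {Q : Bool → Bool → ℝ}

theorem sum_fibres {V : Type*} [Fintype V] (f : V → Bool) (g : V → ℝ) :
    ∑ x, g x = ∑ i, ∑ x, g x * (if f x = i then 1 else 0) := by
  rw [Finset.sum_comm]
  refine Finset.sum_congr rfl fun x _ => ?_
  simp

/-- The size of a fibre. -/
def fibreCard {V : Type*} [Fintype V] (f : V → Bool) (i : Bool) : ℝ :=
  ∑ x, if f x = i then 1 else 0

theorem swap (h : IsBivalent G f s p a Q) :
    IsBivalent G (fun x => !f x) s p (fun i => a !i) (fun i j => Q (!i) (!j)) where
  surj i := by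
    obtain ⟨x, hx⟩ := h.surj (!i)
    exact ⟨x, by simp [hx]⟩
  pos i := h.pos _
  ne := h.ne.symm
  sq x y := by simpa using h.sq x y
  row x i := by
    rw [← Bool.not_not (f x)]
    simpa [Bool.not_eq_eq_eq_not] using h.row x (!i)

/-- Sum a row of the quadratic equation over the columns in fibre `j`. -/
theorem quotient_sq (h : IsBivalent G f s p a Q) (i j : Bool) :
    ∑ k, Q i k * Q k j
      = s * Q i j + p * (if i = j then 1 else 0) + a i * a j * fibreCard f j := by
  obtain ⟨x, rfl⟩ := h.surj i
  have h1 : ∑ y, (G.adjMatrix ℝ * G.adjMatrix ℝ) x y * (if f y = j then 1 else 0)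
      = ∑ k, Q (f x) k * Q k j := by
    simp only [Matrix.mul_apply, Finset.sum_mul]
    rw [Finset.sum_comm]
    have (z : V) : ∑ y, G.adjMatrix ℝ x z * G.adjMatrix ℝ z y * (if f y = j then 1 else 0)
        = G.adjMatrix ℝ x z * Q (f z) j := by
      simp only [mul_assoc, ← Finset.mul_sum, h.row]
    simp only [this]
    rw [sum_fibres f]
    refine Finset.sum_congr rfl fun k _ => ?_
    rw [← h.row x k, Finset.sum_mul]
    refine Finset.sum_congr rfl fun z _ => ?_
    split_ifs with hz
    · rw [hz]; ring
    · ring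
  rw [← h1, fibreCard, ← h.row x j, Finset.mul_sum, Finset.mul_sum]
  have h2 : p * (if f x = j then 1 else 0)
      = ∑ y, p * ((if x = y then 1 else 0) * (if f y = j then 1 else 0)) := by
    rw [← Finset.mul_sum]
    simp only [ite_mul, one_mul, zero_mul, Finset.sum_ite_eq, Finset.mem_univ, if_true]
  rw [h2, ← Finset.sum_add_distrib, ← Finset.sum_add_distrib]
  refine Finset.sum_congr rfl fun y _ => ?_
  rw [h.sq]
  split_ifs with hy <;> simp [*]

/-- Double counting of the adjacent pairs between two fibres. -/
theorem card_mul_quotient (h : IsBivalent G f s p a Q) (i j : Bool) :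
    fibreCard f i * Q i j = fibreCard f j * Q j i := by
  have h1 (i j : Bool) : fibreCard f i * Q i j
      = ∑ x, ∑ y, G.adjMatrix ℝ x y * (if f y = j then 1 else 0) * (if f x = i then 1 else 0) := by
    rw [fibreCard, Finset.sum_mul]
    refine Finset.sum_congr rfl fun x _ => ?_
    rw [← Finset.sum_mul, h.row]
    split_ifs with hx
    · rw [hx]; ring
    · ring
  rw [h1, h1, Finset.sum_comm]
  refine Finset.sum_congr rfl fun x _ => Finset.sum_congr rfl fun y _ => ?_
  rw [G.adjMatrix_comm]
  ring

theorem quotient_row_sum (h : IsBivalent G f s p a Q) (i : Bool) :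
    Q i false + Q i true = p + a i * a i := by
  obtain ⟨x, rfl⟩ := h.surj i
  have h1 := h.sq x x
  rw [SimpleGraph.adjMatrix_mul_self_apply_self] at h1
  have h2 := sum_fibres f (fun y => G.adjMatrix ℝ x y)
  rw [Fintype.sum_bool, h.row, h.row, G.sum_adjMatrix_row] at h2
  simp at h1
  linarith

theorem card_pos (h : IsBivalent G f s p a Q) (i : Bool) : 0 < fibreCard f i := by
  obtain ⟨x, rfl⟩ := h.surj i
  refine Finset.sum_pos' (fun y _ => by positivity) ⟨x, Finset.mem_univ x, by simp⟩

end IsBivalent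

end Bivalent

/-! ### Excluding the case in which all edges between the fibres are present. -/

section Join

/-- Put `c = τ (θ + 1)`, so that `kᵢ - τ = mᵢ - c`. The equation for `m₁ m₂` gives `c = 0` or `c =
m₁ + m₂`. In the second case the nonnegative numbers `kᵢ - τ` equal `-m₂` and `-m₁`, so `c = 0`
again. Thus `θ = -1`, which forces `mᵢ = 0` and `n₁ n₂ = (k₁ + 1)(k₂ + 1)`, against `kᵢ + 1 < nᵢ`.
-/
theorem join_parameters_aux {θ τ k₁ k₂ n₁ n₂ m₁ m₂ : ℝ} (hp : 0 < -(θ * τ))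
    (hk₁ : k₁ = -(θ * τ) + m₁) (hk₂ : k₂ = -(θ * τ) + m₂) (hm₁ : 0 ≤ m₁) (hm₂ : 0 ≤ m₂)
    (hn₁ : k₁ + 1 < n₁) (hn₂ : k₂ + 1 < n₂)
    (h₁ : (k₁ - θ) * (k₁ - τ) = n₁ * m₁) (h₂ : (k₂ - θ) * (k₂ - τ) = n₂ * m₂)
    (hn : n₁ * n₂ = (k₁ - θ) * (k₂ - θ)) (hm : m₁ * m₂ = (k₁ - τ) * (k₂ - τ)) : False := by
  have hτ : τ ≠ 0 := by rintro rfl; simp at hp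
  have hle (k n m : ℝ) (hk : k = -(θ * τ) + m) (hm : 0 ≤ m) (hn : k + 1 < n)
      (h : (k - θ) * (k - τ) = n * m) : 0 ≤ k - τ := by
    by_contra! hlt
    have hτ0 : 0 < τ := by linarith
    have hθ0 : θ < 0 := by
      by_contra! h0
      nlinarith [mul_nonneg h0 hτ0.le]
    have h1 : 0 < k - θ := by linarith
    have h2 := mul_neg_of_pos_of_neg h1 hlt
    have h3 : 0 ≤ n * m := mul_nonneg (by linarith) hm
    linarith
  have hfin (hθ : θ = -1) : False := by
    subst hθ
    have hz (k n m : ℝ) (hk : k = -(-1 * τ) + m) (hn : k + 1 < n)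
        (h : (k - -1) * (k - τ) = n * m) : m = 0 := by
      have h1 : (n - (k + 1)) * m = 0 := by linear_combination -h + (k + 1) * hk
      exact (mul_eq_zero.1 h1).resolve_left (by linarith)
    rw [hz k₁ n₁ m₁ hk₁ hn₁ h₁] at hk₁
    rw [hz k₂ n₂ m₂ hk₂ hn₂ h₂] at hk₂
    have h3 : 0 < k₁ + 1 := by linarith
    have h4 : 0 < k₂ + 1 := by linarith
    have := mul_lt_mul'' hn₁ hn₂ h3.le h4.le
    linarith
  have hc : (τ * (θ + 1)) * (τ * (θ + 1) - (m₁ + m₂)) = 0 := by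
    rw [hk₁, hk₂] at hm
    linear_combination -hm
  rcases mul_eq_zero.1 hc with h | h
  · exact hfin (by linarith [(mul_eq_zero.1 h).resolve_left hτ])
  · have e₁ := hle k₁ n₁ m₁ hk₁ hm₁ hn₁ h₁
    have e₂ := hle k₂ n₂ m₂ hk₂ hm₂ hn₂ h₂
    have f₁ : k₁ - τ = -m₂ := by linear_combination hk₁ - h
    have f₂ : k₂ - τ = -m₁ := by linear_combination hk₂ - h
    have g₁ : m₁ = 0 := by linarith
    have g₂ : m₂ = 0 := by linarith
    have : τ * (θ + 1) = 0 := by rw [g₁, g₂] at h; linarith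
    exact hfin (by linarith [(mul_eq_zero.1 this).resolve_left hτ])

/-- The parameters of a join of two strongly regular graphs with the same restricted eigenvalues
force the join to be regular, if it has only three eigenvalues. -/
theorem join_parameters {θ τ k₁ k₂ n₁ n₂ a₁ a₂ : ℝ} (hk₁ : 0 < k₁) (hk₂ : 0 < k₂)
    (hn₁ : k₁ + 1 < n₁) (hn₂ : k₂ + 1 < n₂) (hm₁ : n₂ ≤ a₁ * a₁) (hm₂ : n₁ ≤ a₂ * a₂)
    (hp : 0 ≤ -(θ * τ)) (hd₁ : k₁ + n₂ = -(θ * τ) + a₁ * a₁) (hd₂ : k₂ + n₁ = -(θ * τ) + a₂ * a₂)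
    (h₁ : k₁ * k₁ + n₂ * n₁ = (θ + τ) * k₁ + -(θ * τ) + a₁ * a₁ * n₁)
    (h₂ : k₂ * k₂ + n₁ * n₂ = (θ + τ) * k₂ + -(θ * τ) + a₂ * a₂ * n₂)
    (h₁₂ : k₁ + k₂ = θ + τ + a₁ * a₂) : k₁ + n₂ = k₂ + n₁ := by
  -- `mᵢ` stands for the number of common neighbours, inside fibre `i`, of two nonadjacent vertices
  -- of that fibre.
  obtain ⟨m₁, rfl⟩ : ∃ m₁, k₁ = -(θ * τ) + m₁ := ⟨k₁ + θ * τ, by ring⟩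
  obtain ⟨m₂, rfl⟩ : ∃ m₂, k₂ = -(θ * τ) + m₂ := ⟨k₂ + θ * τ, by ring⟩
  have e₁ : a₁ * a₁ = m₁ + n₂ := by linarith
  have e₂ : a₂ * a₂ = m₂ + n₁ := by linarith
  rw [e₁] at hm₁ h₁
  rw [e₂] at hm₂ h₂
  set k₁ := -(θ * τ) + m₁ with hk₁'
  set k₂ := -(θ * τ) + m₂ with hk₂'
  have g₁ : (k₁ - θ) * (k₁ - τ) = n₁ * m₁ := by linear_combination h₁
  have g₂ : (k₂ - θ) * (k₂ - τ) = n₂ * m₂ := by linear_combination h₂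
  rcases hp.lt_or_eq with hp | hp
  · have hprod : (k₁ + k₂ - (θ + τ)) ^ 2 = (m₁ + n₂) * (m₂ + n₁) := by
      rw [← e₁, ← e₂, h₁₂]
      ring
    -- The pairs `n₁ n₂, m₁ m₂` and `(k₁ - θ)(k₂ - θ), (k₁ - τ)(k₂ - τ)` have equal sum and equal
    -- product, so they agree up to order. The two orders are exchanged by swapping `θ` and `τ`.
    have hsum : n₁ * n₂ + m₁ * m₂ = (k₁ - θ) * (k₂ - θ) + (k₁ - τ) * (k₂ - τ) := by
      linear_combination -hprod + g₁ + g₂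
    have hmul : (n₁ * n₂) * (m₁ * m₂) = ((k₁ - θ) * (k₂ - θ)) * ((k₁ - τ) * (k₂ - τ)) := by
      linear_combination -(k₂ - θ) * (k₂ - τ) * g₁ - n₁ * m₁ * g₂
    have hor : (n₁ * n₂ - (k₁ - θ) * (k₂ - θ)) * (n₁ * n₂ - (k₁ - τ) * (k₂ - τ)) = 0 := by
      linear_combination n₁ * n₂ * hsum - hmul
    exfalso
    rcases mul_eq_zero.1 hor with h | h
    · exact join_parameters_aux hp hk₁' hk₂' (by linarith) (by linarith) hn₁ hn₂ g₁ g₂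
        (by linarith) (by linarith)
    · rw [mul_comm θ τ] at hp hk₁' hk₂'
      exact join_parameters_aux hp hk₁' hk₂' (by linarith) (by linarith) hn₁ hn₂
        (by linarith) (by linarith) (by linarith) (by linarith)
  -- When `θτ = 0` the equations factor and give `kᵢ - nᵢ = θ + τ` for both fibres.
  · have f₁ : k₁ * (k₁ - (θ + τ) - n₁) = 0 := by
      linear_combination h₁ + (n₁ - 1) * hp + n₁ * hk₁'
    have f₂ : k₂ * (k₂ - (θ + τ) - n₂) = 0 := by
      linear_combination h₂ + (n₂ - 1) * hp + n₂ * hk₂'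
    have f₁ := (mul_eq_zero.1 f₁).resolve_left hk₁.ne'
    have f₂ := (mul_eq_zero.1 f₂).resolve_left hk₂.ne'
    linarith

variable {V : Type*} [Fintype V] [DecidableEq V]

namespace IsBivalent

variable {G : SimpleGraph V} [DecidableRel G.Adj] {f : V → Bool} {s p : ℝ} {a : Bool → ℝ}
  {Q : Bool → Bool → ℝ}

theorem not_joined_of_le_coherentRank {θ τ : ℝ} (h : IsBivalent G f (θ + τ) (-(θ * τ)) a Q)
    (hrank : 8 ≤ coherentRank G) : ∃ x y, f x ≠ f y ∧ ¬ G.Adj x y := by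
  by_contra! hJ
  have hJ' (x y : V) (hxy : f x ≠ f y) : G.adjMatrix ℝ x y = 1 := by
    simp [SimpleGraph.adjMatrix_apply, hJ x y hxy]
  obtain ⟨B, hB⟩ : ∃ B : Matrix V V ℝ, ∀ x y,
      B x y = if f x = f y then G.adjMatrix ℝ x y else 0 := ⟨Matrix.of _, fun _ _ => rfl⟩
  -- Two vertices of one fibre have the whole other fibre as common neighbours. Subtracting its size
  -- turns the equation for `A²` into one for `B²`.
  have hreg : IsFibrewiseRegular f B := by
    refine ⟨fun x y => ?_, fun x => ?_, fun x y => ?_, fun x y hxy => ?_,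
      ⟨fun i => Q i i, fun x => ?_⟩, ⟨fun _ => θ + τ, fun _ => -(θ * τ),
        fun i j => if i = j then a i * a j - fibreCard f (!i) else 0, fun x y => ?_⟩⟩
    · rw [hB, SimpleGraph.adjMatrix_apply]
      split_ifs <;> simp
    · simp [hB]
    · simp only [hB, G.adjMatrix_comm x y, eq_comm]
    · rw [hB, if_neg hxy]
    · beta_reduce
      rw [← h.row x (f x)]
      refine Finset.sum_congr rfl fun y _ => ?_
      rw [hB]
      split_ifs <;> simp_all
    · beta_reduce
      by_cases hxy : f x = f y
      · have h1 := h.sq x y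
        have h2 : (G.adjMatrix ℝ * G.adjMatrix ℝ) x y
            = ∑ z, B x z * B z y + fibreCard f (!f x) := by
          rw [Matrix.mul_apply, fibreCard, ← Finset.sum_add_distrib]
          refine Finset.sum_congr rfl fun z _ => ?_
          rw [hB, hB, ← hxy]
          by_cases hz : f z = f x
          · simp [hz]
          · have hz' : f z = !f x := by simpa [Bool.eq_not] using hz
            rw [hJ' x z (Ne.symm hz), hJ' z y (hxy ▸ hz)]
            simp [hz']
        rw [if_pos hxy, hB, if_pos hxy]
        linarith
      · rw [if_neg hxy, hB, if_neg hxy, if_neg (fun h => hxy (congrArg f h))]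
        simp only [mul_zero, add_zero]
        refine Finset.sum_eq_zero fun z _ => ?_
        rw [hB, hB]
        by_cases hz : f x = f z
        · rw [if_neg (fun h => hxy (hz.trans h)), mul_zero]
        · rw [if_neg hz, zero_mul]
  have hinj := (hreg.map Complex.ofRealHom).injective (G := G)
    ⟨(0, fun _ => 1, fun i j => if i = j then 0 else 1), by
      rw [← G.map_ofReal_adjMatrix]
      ext x y
      rw [fibreMap_apply, Matrix.map_apply, Matrix.map_apply, hB]
      by_cases hxy : f x = f y
      · simp [hxy]
      · simp [hxy, hJ x y hxy]⟩ (by simpa using hrank)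
  have hker (c) (hc : fibreMap f (B.map Complex.ofRealHom) c = 0) : c = 0 :=
    hinj (hc.trans (map_zero _).symm)
  -- An empty fibre graph would be a linear relation among the eight pieces; so would a complete
  -- one, through `I + B - J = 0` on that fibre.
  have hedge (i : Bool) : ∃ x y, f x = i ∧ f y = i ∧ G.Adj x y := by
    by_contra! hno
    have := hker (0, fun j => if j = i then 1 else 0, 0) (by
      ext x y
      rw [fibreMap_apply, Matrix.map_apply, hB]
      by_cases hxy : f x = f y
      · by_cases hi : f x = i
        · simp [hxy, SimpleGraph.adjMatrix_apply, hno x y hi (hxy ▸ hi)]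
        · simp [hi]
      · simp [hxy])
    simpa using congrFun (congrArg (fun c => c.2.1) this) i
  have hnonedge (i : Bool) : ∃ x y, f x = i ∧ f y = i ∧ x ≠ y ∧ ¬ G.Adj x y := by
    by_contra! hno
    have := hker (fun j => if j = i then 1 else 0, fun j => if j = i then 1 else 0,
      fun j k => if j = i ∧ k = i then -1 else 0) (by
      ext x y
      rw [fibreMap_apply, Matrix.map_apply, hB]
      by_cases hx : f x = i
      · by_cases hy : f y = i
        · by_cases hxy : x = y
          · simp [hxy, hy]
          · simp [hx, hy, hxy, SimpleGraph.adjMatrix_apply, hno x y hx hy hxy]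
        · have hxy : x ≠ y := fun e => hy (e ▸ hx)
          simp [hx, hy, hxy, Ne.symm hy]
      · simp [hx])
    simpa using congrFun (congrArg (fun c => c.1) this) i
  have hQ (i : Bool) : Q i (!i) = fibreCard f (!i) := by
    obtain ⟨x, rfl⟩ := h.surj i
    rw [← h.row, fibreCard]
    refine Finset.sum_congr rfl fun y _ => ?_
    split_ifs with hy
    · rw [hJ' x y (by simp [hy]), mul_one]
    · rw [mul_zero]
  have hk (i : Bool) : 0 < Q i i := by
    obtain ⟨x, y, rfl, hy, hxy⟩ := hedge i
    rw [← h.row]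
    refine Finset.sum_pos' (fun z _ => ?_) ⟨y, Finset.mem_univ y, by simp [hy, hxy]⟩
    rw [SimpleGraph.adjMatrix_apply]
    positivity
  have hn (i : Bool) : Q i i + 1 < fibreCard f i := by
    obtain ⟨x, y, rfl, hy, hne, hxy⟩ := hnonedge i
    have h1 : ∑ z, ((if z = x then (1 : ℝ) else 0) + (if z = y then 1 else 0))
        ≤ ∑ z, ((if f z = f x then 1 else 0)
          - G.adjMatrix ℝ x z * (if f z = f x then 1 else 0)) := by
      refine Finset.sum_le_sum fun z _ => ?_
      by_cases h1 : z = x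
      · subst h1
        simp [hne]
      · by_cases h2 : z = y
        · subst h2
          simp [h1, hy, hxy]
        · rw [SimpleGraph.adjMatrix_apply, if_neg h1, if_neg h2]
          split_ifs <;> simp
    rw [Finset.sum_sub_distrib, h.row, Finset.sum_add_distrib] at h1
    simp only [Finset.sum_ite_eq', Finset.mem_univ, if_true] at h1
    rw [fibreCard]
    linarith
  -- For nonadjacent vertices of fibre `i`, `a i * a i` counts their common neighbours: at least the
  -- whole other fibre, at most a degree.
  have hsq (i : Bool) : fibreCard f (!i) ≤ a i * a i ∧ a i * a i ≤ Q i false + Q i true := by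
    obtain ⟨x, y, rfl, hy, hne, hxy⟩ := hnonedge i
    have h1 := h.sq x y
    rw [if_neg hne, SimpleGraph.adjMatrix_apply, if_neg hxy, hy, mul_zero, mul_zero, zero_add,
      zero_add, Matrix.mul_apply] at h1
    rw [← h1]
    constructor
    · refine Finset.sum_le_sum fun z _ => ?_
      split_ifs with hz
      · rw [hJ' x z (by simp [hz]), hJ' z y (by simp [hz, hy]), mul_one]
      · rw [SimpleGraph.adjMatrix_apply, SimpleGraph.adjMatrix_apply]
        positivity
    · rw [← h.row, ← h.row, ← Finset.sum_add_distrib]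
      refine Finset.sum_le_sum fun z _ => ?_
      rw [SimpleGraph.adjMatrix_apply, SimpleGraph.adjMatrix_apply]
      cases f z <;> split_ifs <;> simp_all
  have q₁ := h.quotient_sq false false
  have q₂ := h.quotient_sq true true
  have q₁₂ := h.quotient_sq false true
  have d₁ := h.quotient_row_sum false
  have d₂ := h.quotient_row_sum true
  have hQ₁ : Q false true = fibreCard f true := hQ false
  have hQ₂ : Q true false = fibreCard f false := hQ true
  have s₁ := hsq false
  have s₂ := hsq true
  have hc := h.card_pos true
  simp only [Fintype.sum_bool, hQ₁, hQ₂, if_true, mul_one, Bool.not_false, Bool.not_true,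
    Bool.false_eq_true, if_false, mul_zero, add_zero]
    at q₁ q₂ q₁₂ d₁ d₂ s₁ s₂
  have q₁₂' : Q false false + Q true true = θ + τ + a false * a true :=
    mul_right_cancel₀ hc.ne' (by linear_combination q₁₂)
  have := join_parameters (hk false) (hk true) (hn false) (hn true) s₁.1 s₂.1 (by linarith)
    d₁ (by linarith) (by linarith) (by linarith) q₁₂'
  have h2 : a false * a false = a true * a true := by linarith
  exact h.ne ((mul_self_inj (h.pos _).le (h.pos _).le).1 h2)

end IsBivalent

end Join

/-! ### Nontrivial edges between the fibres: the fibres are a clique and a coclique. -/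

section Incidence

variable {V : Type*} [Fintype V] [DecidableEq V]

namespace IsBivalent

variable {G : SimpleGraph V} [DecidableRel G.Adj] {f : V → Bool} {s p : ℝ} {a : Bool → ℝ}
  {Q : Bool → Bool → ℝ}

theorem _root_.SimpleGraph.Connected.exists_adj_of_surjective {V : Type*} {G : SimpleGraph V}
    (hG : G.Connected) {f : V → Bool} (hf : Function.Surjective f) :
    ∃ x y, f x ≠ f y ∧ G.Adj x y := by
  by_contra! hno
  obtain ⟨x, hx⟩ := hf false
  obtain ⟨y, hy⟩ := hf true
  obtain ⟨w⟩ := hG.preconnected x y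
  have : f x = f y := by
    clear hx hy
    induction w with
    | nil => rfl
    | cons hadj _ ih => exact (not_imp_not.1 (hno _ _) hadj).trans ih
  simp [hx, hy] at this

theorem exists_cross {V : Type*} {P : V → V → Prop} (hP : ∀ x y, P x y → P y x) {f : V → Bool}
    (h : ∃ x y, f x ≠ f y ∧ P x y) (i : Bool) : ∃ x y, f x = i ∧ f y = !i ∧ P x y := by
  obtain ⟨x, y, hne, hxy⟩ := h
  by_cases hx : f x = i
  · exact ⟨x, y, hx, by rw [← hx, Bool.eq_not]; exact hne.symm, hxy⟩
  · have hx' : f x = !i := by rw [Bool.eq_not]; exact hx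
    refine ⟨y, x, ?_, hx', hP _ _ hxy⟩
    rw [hx'] at hne
    simpa using hne.symm

/-- By equitability, a fibre with a single vertex would be joined to all of the other fibre or to
none of it. -/
theorem exists_ne_of_cross (h : IsBivalent G f s p a Q) (hadj : ∃ x y, f x ≠ f y ∧ G.Adj x y)
    (hnadj : ∃ x y, f x ≠ f y ∧ ¬ G.Adj x y) (i : Bool) : ∃ x y, f x = i ∧ f y = i ∧ x ≠ y := by
  by_contra! hone
  obtain ⟨x, y, hx, hy, hxy⟩ := exists_cross (fun _ _ => G.adj_symm) hadj i
  obtain ⟨x', y', hx', hy', hxy'⟩ :=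
    exists_cross (fun _ _ h h' => h (G.adj_symm h')) hnadj i
  have hrow (y : V) : Q (f y) i = G.adjMatrix ℝ y x := by
    rw [← h.row y i, Finset.sum_eq_single x]
    · simp [hx]
    · intro z _ hz
      rw [if_neg fun h => hz (hone z x h hx), mul_zero]
    · simp
  have h1 := hrow y
  rw [hy, ← hy', hrow y', hone x x' hx hx'] at h1
  rw [hone x x' hx hx'] at hxy
  simp [SimpleGraph.adjMatrix_apply, G.adj_comm y' x', G.adj_comm y x', hxy, hxy'] at h1

/-- If the edges between the fibres are nontrivial and the coherent rank is `8`, then each fibre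
is a clique or a coclique. -/
theorem exists_fibre_entry {F : ℕ → Bool} (h : IsBivalent G (fun x => F (G.degree x)) s p a Q)
    (hadj : ∃ x y, F (G.degree x) ≠ F (G.degree y) ∧ G.Adj x y)
    (hnadj : ∃ x y, F (G.degree x) ≠ F (G.degree y) ∧ ¬ G.Adj x y) (hrank : coherentRank G ≤ 8) :
    ∃ e : Bool → ℝ, (∀ i, e i = 0 ∨ e i = 1) ∧
      ∀ x y, x ≠ y → F (G.degree x) = F (G.degree y) →
        G.adjMatrix ℝ x y = e (F (G.degree x)) := by
  obtain ⟨⟨hS, hA⟩, -⟩ := coherentClosure_isLeast G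
  have hC := hS.hadamard_mem _ hA _
    (of_degree_mem_coherentClosure G F fun i j => if i = j then 0 else 1)
  have hinj : Function.Injective (fibreMap (fun x => F (G.degree x))
      ((G.adjMatrix ℂ).hadamard (Matrix.of fun x y =>
        (fun i j => if i = j then 0 else 1) (F (G.degree x)) (F (G.degree y))))) := by
    rw [← LinearMap.ker_eq_bot, LinearMap.ker_eq_bot']
    rintro ⟨u, v, w⟩ hc
    have hc (x y : V) := congrFun (congrFun hc x) y
    simp only [fibreMap_apply, Matrix.hadamard_apply, Matrix.of_apply, Matrix.zero_apply,
      SimpleGraph.adjMatrix_apply] at hc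
    -- The coefficients are read off one at a time: at a nonedge between the fibres, at an edge
    -- between them, at two distinct vertices of a fibre, and on the diagonal.
    have hw (i : Bool) : w i (!i) = 0 := by
      obtain ⟨x, y, hx, hy, hxy⟩ := exists_cross (fun _ _ h h' => h (G.adj_symm h')) hnadj i
      have hne : x ≠ y := by
        rintro rfl
        simp [hx] at hy
      simpa [hx, hy, hxy, hne] using hc x y
    have hv (i : Bool) : v i = 0 := by
      obtain ⟨x, y, hx, hy, hxy⟩ := exists_cross (fun _ _ => G.adj_symm) hadj i
      simpa [hx, hy, hxy, hxy.ne, hw i] using hc x y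
    have hw' (i : Bool) : w i i = 0 := by
      obtain ⟨x, y, hx, hy, hxy⟩ := h.exists_ne_of_cross hadj hnadj i
      simpa [hx, hy, hxy] using hc x y
    have hu (i : Bool) : u i = 0 := by
      obtain ⟨x, hx⟩ := h.surj i
      simpa [hx, hw' i] using hc x x
    refine Prod.ext (funext hu) (Prod.ext (funext hv) (funext fun i => funext fun j => ?_))
    by_cases hij : j = i
    · rw [hij]
      exact hw' i
    · rw [show j = !i by rw [Bool.eq_not]; exact hij]
      exact hw i
  obtain ⟨⟨u, v, w⟩, hAw⟩ := mem_range_fibreMap_of_injective G F hC hinj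
    (by simpa using hrank) hA
  -- Off the diagonal inside a fibre, only the constant block term survives, because the further
  -- matrix lives between the fibres.
  have hAw (x y : V) (hxy : x ≠ y) (hf : F (G.degree x) = F (G.degree y)) :
      G.adjMatrix ℂ x y = w (F (G.degree x)) (F (G.degree x)) := by
    rw [← hAw, fibreMap_apply]
    simp [hxy, hf]
  refine ⟨fun i => if w i i = 1 then 1 else 0, fun i => ?_, fun x y hxy hf => ?_⟩
  · by_cases hi : w i i = 1 <;> simp [hi]
  · beta_reduce
    rw [← hAw x y hxy hf, SimpleGraph.adjMatrix_apply, SimpleGraph.adjMatrix_apply]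
    split_ifs <;> simp_all

/-- Walks of length two are sorted by the fibre of the middle vertex `z`. The step inside a fibre
has constant weight, except that `z = x` and `z = y` must be excluded; this gives the subtracted
entries. -/
theorem sq_apply_cross (h : IsBivalent G f s p a Q) {e : Bool → ℝ}
    (he : ∀ x y, x ≠ y → f x = f y → G.adjMatrix ℝ x y = e (f x)) {x y : V} (hxy : f y = !f x) :
    (G.adjMatrix ℝ * G.adjMatrix ℝ) x y = e (f x) * (Q (f y) (f x) - G.adjMatrix ℝ x y)
      + e (f y) * (Q (f x) (f y) - G.adjMatrix ℝ x y) := by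
  have hterm (z : V) : G.adjMatrix ℝ x z * G.adjMatrix ℝ z y
      = e (f x) * (G.adjMatrix ℝ y z * (if f z = f x then 1 else 0)
          - (if z = x then G.adjMatrix ℝ x y else 0))
        + e (f y) * (G.adjMatrix ℝ x z * (if f z = f y then 1 else 0)
          - (if z = y then G.adjMatrix ℝ x y else 0)) := by
    rw [G.adjMatrix_comm y z]
    by_cases hz : f z = f x
    · have hzy : z ≠ y := by
        rintro rfl
        simp [hz] at hxy
      by_cases hzx : z = x
      · subst hzx
        simp [hxy, hzy]
      · rw [he x z (Ne.symm hzx) hz.symm]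
        simp [hz, hxy, hzx, hzy]
    · have hz' : f z = f y := by rw [hxy, Bool.eq_not]; exact hz
      have hzx : z ≠ x := by
        rintro rfl
        exact hz rfl
      by_cases hzy : z = y
      · subst hzy
        simp [hxy, hzx]
      · rw [he z y hzy hz', hz']
        simp [hxy, hzx, hzy, mul_comm]
  rw [Matrix.mul_apply, Finset.sum_congr rfl fun z _ => hterm z]
  simp only [Finset.sum_add_distrib, ← Finset.mul_sum, Finset.sum_sub_distrib, h.row,
    Finset.sum_ite_eq', Finset.mem_univ, if_true]

theorem quotient_self (h : IsBivalent G f s p a Q) {e : Bool → ℝ}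
    (he : ∀ x y, x ≠ y → f x = f y → G.adjMatrix ℝ x y = e (f x)) (i : Bool) :
    Q i i = e i * (fibreCard f i - 1) := by
  obtain ⟨x, rfl⟩ := h.surj i
  have hterm (y : V) : G.adjMatrix ℝ x y * (if f y = f x then 1 else 0)
      = e (f x) * ((if f y = f x then 1 else 0) - (if y = x then 1 else 0)) := by
    by_cases hyx : y = x
    · simp [hyx]
    · by_cases hy : f y = f x
      · rw [he x y (Ne.symm hyx) hy.symm]
        simp [hy, hyx]
      · simp [hy, hyx]
  rw [← h.row, Finset.sum_congr rfl fun y _ => hterm y, ← Finset.mul_sum, Finset.sum_sub_distrib,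
    fibreCard]
  simp

theorem quotient_lt_card (h : IsBivalent G f s p a Q) (hnadj : ∃ x y, f x ≠ f y ∧ ¬ G.Adj x y)
    (i : Bool) : Q (!i) i < fibreCard f i := by
  obtain ⟨y, x, hy, hx, hxy⟩ := exists_cross (fun _ _ h h' => h (G.adj_symm h')) hnadj i
  rw [← hx, ← h.row, fibreCard]
  refine Finset.sum_lt_sum (fun z _ => ?_) ⟨y, Finset.mem_univ y, ?_⟩
  · rw [SimpleGraph.adjMatrix_apply]
    split_ifs <;> simp
  · simp [hy, SimpleGraph.adjMatrix_apply, G.adj_comm x y, hxy]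

/-- Evaluate `A²` at an edge and at a nonedge between the fibres. The nonedge gives the second
equation, the difference the first. -/
theorem entry_equations (h : IsBivalent G f s p a Q)
    (hadj : ∃ x y, f x ≠ f y ∧ G.Adj x y) (hnadj : ∃ x y, f x ≠ f y ∧ ¬ G.Adj x y) {e : Bool → ℝ}
    (he : ∀ x y, x ≠ y → f x = f y → G.adjMatrix ℝ x y = e (f x)) :
    s = -(e false + e true) ∧
      a false * a true = e false * Q true false + e true * Q false true := by
  obtain ⟨x, y, hx, hy, hxy⟩ := exists_cross (fun _ _ => G.adj_symm) hadj false
  obtain ⟨x', y', hx', hy', hxy'⟩ :=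
    exists_cross (fun _ _ h h' => h (G.adj_symm h')) hnadj false
  have h1 := h.sq x y
  have h2 := h.sq x' y'
  have hne : x' ≠ y' := by
    rintro rfl
    simp [hx'] at hy'
  rw [h.sq_apply_cross he (by rw [hx, hy])] at h1
  rw [h.sq_apply_cross he (by rw [hx', hy'])] at h2
  simp only [hx, hy, hx', hy', SimpleGraph.adjMatrix_apply, hxy, hxy', if_true, if_false, hxy.ne,
    hne, Bool.not_false] at h1 h2
  constructor <;> linarith

/-- A clique fibre and a coclique fibre give the parameters of the design. -/
theorem parameters_of_coclique_clique {θ τ : ℝ} (hne : θ ≠ τ)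
    (h : IsBivalent G f (θ + τ) (-(θ * τ)) a Q) (hadj : ∃ x y, f x ≠ f y ∧ G.Adj x y)
    (hnadj : ∃ x y, f x ≠ f y ∧ ¬ G.Adj x y) {e : Bool → ℝ}
    (he : ∀ x y, x ≠ y → f x = f y → G.adjMatrix ℝ x y = e (f x))
    (he₀ : e false = 0) (he₁ : e true = 1) :
    fibreCard f true = fibreCard f false ∧ Q true false = (a false * a false) ^ 2 ∧
      fibreCard f false = (a false * a false) ^ 3 - a false * a false + 1 ∧
      a true * a true = a false * a false + fibreCard f false - 1 ∧ θ + τ = -1 := by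
  obtain ⟨hs, ha⟩ := h.entry_equations hadj hnadj he
  have q₁ := h.quotient_sq false false
  have q₂ := h.quotient_sq true true
  have d₁ := h.quotient_row_sum false
  have d₂ := h.quotient_row_sum true
  have c := h.card_mul_quotient false true
  have e₁ := h.quotient_self he false
  have e₂ := h.quotient_self he true
  have n₁ := h.card_pos false
  have hlt := h.quotient_lt_card hnadj false
  have hk := mul_pos (h.pos false) (h.pos true)
  have hl := mul_pos (h.pos false) (h.pos false)
  simp only [Fintype.sum_bool, if_true, mul_one, Bool.not_false] at q₁ q₂ hlt
  rw [he₀, he₁] at ha hs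
  rw [he₀, zero_mul] at e₁
  rw [he₁, one_mul] at e₂
  rw [e₁] at q₁ d₁
  rw [e₂] at q₂ d₂
  rw [zero_mul, zero_add, one_mul] at ha
  obtain rfl : τ = -1 - θ := by linarith
  -- If this vanished, every clique vertex would be adjacent to the whole coclique, against the
  -- nonedge.
  have hp : -(θ * (-1 - θ)) ≠ 0 := by
    intro hp
    have g : Q false true * (fibreCard f false - Q true false) = 0 := by
      linear_combination (fibreCard f false - 1) * hp - q₁ + d₁ * fibreCard f false
    rw [← ha] at g
    have := (mul_eq_zero.1 g).resolve_left hk.ne'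
    linarith
  have g : -(θ * (-1 - θ)) * (fibreCard f false - fibreCard f true) = 0 := by
    linear_combination q₁ - q₂ - d₁ * fibreCard f false + d₂ * fibreCard f true + c
  have hn := sub_eq_zero.1 ((mul_eq_zero.1 g).resolve_left hp)
  have hQ : Q false true = Q true false := by
    rw [← hn] at c
    exact mul_left_cancel₀ n₁.ne' c
  have ha₂ : a true * a true = a false * a false + fibreCard f false - 1 := by
    linear_combination d₁ - d₂ - hQ - hn
  -- With `λ = a false * a false`, block size `k` and `n` points, this reads `k² = λ (λ + n - 1)`.
  -- Together with `k = λ²`, cancelling `λ` gives `n = λ³ - λ + 1`.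
  have hsq : Q true false ^ 2
      = (a false * a false) * (a false * a false + fibreCard f false - 1) := by
    rw [← hQ, ← ha, ← ha₂]
    ring
  have hk' : Q true false = (a false * a false) ^ 2 := by
    linear_combination d₁ + hsq - q₁ - (1 - Q true false) * hQ
  refine ⟨hn.symm, hk', ?_, ha₂, hs.trans (by norm_num)⟩
  rw [hk'] at hsq
  exact mul_left_cancel₀ hl.ne' (by linear_combination -hsq)

/-- The fibres are not both cocliques or both cliques. -/
theorem entry_ne {θ τ : ℝ} (hne : θ ≠ τ)
    (h : IsBivalent G f (θ + τ) (-(θ * τ)) a Q) (hadj : ∃ x y, f x ≠ f y ∧ G.Adj x y)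
    (hnadj : ∃ x y, f x ≠ f y ∧ ¬ G.Adj x y) {e : Bool → ℝ} (he01 : ∀ i, e i = 0 ∨ e i = 1)
    (he : ∀ x y, x ≠ y → f x = f y → G.adjMatrix ℝ x y = e (f x)) : e false ≠ e true := by
  intro heq
  obtain ⟨hs, ha⟩ := h.entry_equations hadj hnadj he
  rcases he01 true with h1 | h1
  · rw [heq, h1] at ha
    have := mul_pos (h.pos false) (h.pos true)
    linarith
  · have q₁ := h.quotient_sq false false
    have q₂ := h.quotient_sq true true
    have d₁ := h.quotient_row_sum false
    have d₂ := h.quotient_row_sum true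
    have c := h.card_mul_quotient false true
    have e₁ := h.quotient_self he false
    have e₂ := h.quotient_self he true
    have n₁ := h.card_pos false
    simp only [Fintype.sum_bool, if_true, mul_one] at q₁ q₂
    rw [heq, h1] at e₁ hs
    rw [h1] at e₂
    rw [e₁] at q₁ d₁
    rw [e₂] at q₂ d₂
    obtain rfl : τ = -2 - θ := by linarith
    -- Two cliques give `θ + τ = -2`, so `θ = -1` would make the eigenvalues coincide. Otherwise the
    -- fibres have equal sizes and degrees, hence equal eigenvector entries.
    have hθ : θ + 1 ≠ 0 := fun h0 => hne (by linarith)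
    have g : (θ + 1) ^ 2 * (fibreCard f false - fibreCard f true) = 0 := by
      linear_combination q₁ - q₂ - d₁ * fibreCard f false + d₂ * fibreCard f true + c
    have hn := sub_eq_zero.1 ((mul_eq_zero.1 g).resolve_left (pow_ne_zero 2 hθ))
    have hQ : Q false true = Q true false := by
      rw [← hn] at c
      exact mul_left_cancel₀ n₁.ne' c
    have h2 : a false * a false = a true * a true := by
      rw [← hn, ← hQ] at d₂
      linarith
    exact h.ne ((mul_self_inj (h.pos _).le (h.pos _).le).1 h2)

end IsBivalent

end Incidence

/-! ### Reading the design off the graph. -/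

section Assembly

variable {V : Type*} [Fintype V] [DecidableEq V]

/-- An enumeration of the two fibres of a function to `Bool`. -/
theorem exists_fibre_equiv {V : Type*} [Fintype V] (f : V → Bool) :
    ∃ (v b : ℕ) (e : V ≃ Fin v ⊕ Fin b),
      (∀ i, f (e.symm (.inl i)) = false) ∧ ∀ j, f (e.symm (.inr j)) = true :=
  ⟨_, _, (Equiv.sumCompl fun x => f x = false).symm.trans
      (Equiv.sumCongr (Fintype.equivFin {x // f x = false}) (Fintype.equivFin {x // ¬ f x = false})),
    fun i => ((Fintype.equivFin {x // f x = false}).symm i).2,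
    fun j => by simpa using ((Fintype.equivFin {x // ¬ f x = false}).symm j).2⟩

namespace IsBivalent

variable {G : SimpleGraph V} [DecidableRel G.Adj] {f : V → Bool} {a : Bool → ℝ}
  {Q : Bool → Bool → ℝ}

/-- Points are the coclique vertices, and blocks are the neighbourhoods of the clique vertices in
the coclique. Entries of `A²` at two points count the blocks through both; at two clique vertices
they count the intersection of the blocks plus the rest of the clique. -/
theorem exists_design {θ τ : ℝ} (hne : θ ≠ τ)
    (h : IsBivalent G f (θ + τ) (-(θ * τ)) a Q) (hadj : ∃ x y, f x ≠ f y ∧ G.Adj x y)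
    (hnadj : ∃ x y, f x ≠ f y ∧ ¬ G.Adj x y) {c : Bool → ℝ}
    (hc : ∀ x y, x ≠ y → f x = f y → G.adjMatrix ℝ x y = c (f x))
    (hc₀ : c false = 0) (hc₁ : c true = 1) :
    ∃ (lam v b : ℕ) (blk : Fin b → Finset (Fin v)) (e : V ≃ Fin v ⊕ Fin b),
      IsSymmetricTwoDesign (lam ^ 3 - lam + 1) (lam ^ 2) lam blk ∧
      Matrix.reindex e e (G.adjMatrix ℝ) =
        Matrix.fromBlocks 0 (blockIncidence blk) (blockIncidence blk).transpose
          ((Matrix.of fun _ _ => (1 : ℝ)) - 1) := by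
  obtain ⟨hcard, hk, hn, ha, hs⟩ := h.parameters_of_coclique_clique hne hadj hnadj hc hc₀ hc₁
  obtain ⟨v, b, e, he₀, he₁⟩ := exists_fibre_equiv f
  set P : Fin v → V := fun i => e.symm (.inl i) with hP
  set B : Fin b → V := fun j => e.symm (.inr j) with hB
  have hPinj : Function.Injective P := e.symm.injective.comp Sum.inl_injective
  have hBinj : Function.Injective B := e.symm.injective.comp Sum.inr_injective
  have hsum (g : V → ℝ) : ∑ x, g x = ∑ i, g (P i) + ∑ j, g (B j) := by
    rw [← e.symm.sum_comp, Fintype.sum_sum_type]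
  have hPP (i i' : Fin v) : G.adjMatrix ℝ (P i) (P i') = 0 := by
    by_cases hi : P i = P i'
    · simp [hi]
    · rw [hc _ _ hi (by rw [he₀, he₀]), he₀, hc₀]
  have hBB (j j' : Fin b) : G.adjMatrix ℝ (B j) (B j') = 1 - if j = j' then 1 else 0 := by
    by_cases hj : j = j'
    · simp [hj]
    · rw [hc _ _ (hBinj.ne hj) (by rw [he₁, he₁]), he₁, hc₁, if_neg hj, sub_zero]
  have hv : (v : ℝ) = fibreCard f false := by
    simp [fibreCard, hsum, hP, hB, he₀, he₁]
  have hb : (b : ℝ) = fibreCard f true := by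
    simp [fibreCard, hsum, hP, hB, he₀, he₁]
  -- Integrality: this real number counts the common neighbours of two distinct coclique vertices.
  obtain ⟨lam, hlam⟩ : ∃ lam : ℕ, (lam : ℝ) = a false * a false := by
    obtain ⟨x, y, hx, hy, hxy⟩ := h.exists_ne_of_cross hadj hnadj false
    refine ⟨(Finset.univ.filter fun z => G.Adj x z ∧ G.Adj z y).card, ?_⟩
    have h1 := h.sq x y
    rw [if_neg hxy, hc x y hxy (hx.trans hy.symm), hx, hy, hc₀, mul_zero, mul_zero, zero_add,
      zero_add, Matrix.mul_apply] at h1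
    rw [← h1, Finset.card_filter]
    push_cast
    refine Finset.sum_congr rfl fun z _ => ?_
    simp only [SimpleGraph.adjMatrix_apply, ite_and]
    split_ifs <;> simp
  rw [← hlam] at hk hn ha
  have hvlam : v = lam ^ 3 - lam + 1 := by
    have hle : lam ≤ lam ^ 3 := Nat.le_self_pow (by norm_num) lam
    rw [← hv] at hn
    have : v + lam = lam ^ 3 + 1 := by
      have : (v : ℝ) + lam = lam ^ 3 + 1 := by linarith
      exact_mod_cast this
    omega
  have hbv : b = v := by
    have : (b : ℝ) = v := by rw [hb, hv, hcard]
    exact_mod_cast this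
  let blk : Fin b → Finset (Fin v) := fun j => Finset.univ.filter fun i => G.Adj (P i) (B j)
  have hblk (i : Fin v) (j : Fin b) : i ∈ blk j ↔ G.Adj (P i) (B j) := by simp [blk]
  have hlampos : 0 < lam := by
    have : (0 : ℝ) < lam := by
      rw [hlam]
      exact mul_pos (h.pos _) (h.pos _)
    exact_mod_cast this
  have hcardblk (j : Fin b) : (blk j).card = lam ^ 2 := by
    have h1 := h.row (B j) false
    rw [he₁, hk, hsum] at h1
    simp only [hP, hB, he₀, he₁, if_true, mul_one, Bool.true_eq_false, if_false, mul_zero,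
      Finset.sum_const_zero, add_zero] at h1
    have h2 : ((blk j).card : ℝ) = lam ^ 2 := by
      rw [← h1, Finset.card_filter]
      push_cast
      refine Finset.sum_congr rfl fun i _ => ?_
      rw [G.adjMatrix_comm, SimpleGraph.adjMatrix_apply]
    exact_mod_cast h2
  refine ⟨lam, v, b, blk, e, ⟨⟨?_, ?_, ?_, hcardblk, ?_⟩, ?_, lam, ?_⟩, ?_⟩
  · rw [Fintype.card_fin, hvlam]
  · exact Nat.one_le_pow _ _ hlampos
  · have hvpos : 0 < b := by
      have := h.card_pos true
      rw [← hb] at this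
      exact_mod_cast this
    rw [← hvlam, ← hcardblk ⟨0, hvpos⟩]
    exact (Finset.card_le_univ _).trans (by simp)
  · intro S hS
    obtain ⟨i, i', hii, rfl⟩ := Finset.card_eq_two.1 hS
    have h1 := h.sq (P i) (P i')
    rw [if_neg (hPinj.ne hii), hPP, Matrix.mul_apply, hsum, he₀, he₀, ← hlam] at h1
    simp only [hPP, mul_zero, Finset.sum_const_zero, zero_add] at h1
    have h2 : ((Finset.univ.filter fun j => {i, i'} ⊆ blk j).card : ℝ) = lam := by
      rw [← h1, Finset.card_filter]
      push_cast
      refine Finset.sum_congr rfl fun j _ => ?_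
      rw [G.adjMatrix_comm (B j), SimpleGraph.adjMatrix_apply, SimpleGraph.adjMatrix_apply]
      simp only [Finset.insert_subset_iff, Finset.singleton_subset_iff, hblk, ite_and]
      split_ifs <;> simp
    exact_mod_cast h2
  · rw [Fintype.card_fin, hbv, hvlam]
  · intro j j' hjj
    have h1 := h.sq (B j) (B j')
    rw [if_neg (hBinj.ne hjj), hBB, if_neg hjj, Matrix.mul_apply, hsum, he₁, he₁, ha] at h1
    -- All clique vertices other than the two given ones are common neighbours.
    have h3 : ∑ k, G.adjMatrix ℝ (B j) (B k) * G.adjMatrix ℝ (B k) (B j') = b - 2 := by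
      have (k : Fin b) : G.adjMatrix ℝ (B j) (B k) * G.adjMatrix ℝ (B k) (B j')
          = 1 - (if j = k then 1 else 0) - (if k = j' then 1 else 0) := by
        rw [hBB, hBB]
        by_cases h1 : j = k
        · subst h1
          simp [hjj]
        · simp [h1]
      simp only [this, Finset.sum_sub_distrib, Finset.sum_ite_eq, Finset.sum_ite_eq',
        Finset.mem_univ, if_true]
      simp
      ring
    have h2 : ((blk j ∩ blk j').card : ℝ) = lam := by
      have h4 : ((blk j ∩ blk j').card : ℝ)
          = ∑ i, G.adjMatrix ℝ (B j) (P i) * G.adjMatrix ℝ (P i) (B j') := by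
        have : blk j ∩ blk j'
            = Finset.univ.filter fun i => G.Adj (P i) (B j) ∧ G.Adj (P i) (B j') := by
          ext i
          simp [hblk]
        rw [this, Finset.card_filter]
        push_cast
        refine Finset.sum_congr rfl fun i _ => ?_
        rw [G.adjMatrix_comm (B j), SimpleGraph.adjMatrix_apply, SimpleGraph.adjMatrix_apply]
        simp only [ite_and]
        split_ifs <;> simp
      rw [h4]
      rw [h3, hs, hb, hcard] at h1
      linarith
    exact_mod_cast h2
  · ext x y
    rcases x with i | j <;> rcases y with i' | j'
    · simpa using hPP i i'
    · simp [blockIncidence, hblk, P, B]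
    · simp [blockIncidence, hblk, P, B, G.adj_comm]
    · simpa [Matrix.one_apply] using hBB j j'

end IsBivalent

end Assembly

/-- In `lam ^ 3 - lam + 1` the subtraction of natural numbers is exact, because
`lam ≤ lam ^ 3`. -/
theorem theorem4p2 {V : Type*} [Fintype V] [DecidableEq V] (G : SimpleGraph V)
    [DecidableRel G.Adj] (hG : IsConnectedWithThreeEigenvalues G) (hrank : coherentRank G = 8) :
    ∃ (lam v b : ℕ) (blk : Fin b → Finset (Fin v)) (e : V ≃ Fin v ⊕ Fin b),
      IsSymmetricTwoDesign (lam ^ 3 - lam + 1) (lam ^ 2) lam blk ∧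
      Matrix.reindex e e (G.adjMatrix ℝ) =
        Matrix.fromBlocks 0 (blockIncidence blk) (blockIncidence blk).transpose
          ((Matrix.of fun _ _ => (1 : ℝ)) - 1) := by
  obtain ⟨F, θ, τ, a, Q, hne, h⟩ := hG.exists_isBivalent (by omega) (by omega)
  have hadj := hG.1.exists_adj_of_surjective h.surj
  have hnadj := h.not_joined_of_le_coherentRank hrank.ge
  obtain ⟨c, hc01, hc⟩ := h.exists_fibre_entry hadj hnadj hrank.le
  have hcne := h.entry_ne hne hadj hnadj hc01 hc
  rcases hc01 false with h0 | h0 <;> rcases hc01 true with h1 | h1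
  · exact absurd (h0.trans h1.symm) hcne
  · exact h.exists_design hne hadj hnadj hc h0 h1
  -- Here the clique carries the label `false`, so the labels are exchanged.
  · refine h.swap.exists_design hne (by simpa using hadj) (by simpa using hnadj)
      (c := fun i => c (!i)) (fun x y hxy hf => ?_) h1 h0
    simpa using hc x y hxy (by simpa using hf)
  · exact absurd (h0.trans h1.symm) hcne
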